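/- Let $S$ be a finite set. For $f,\nu:S\to\mathbb R$ write $\langle f,\nu\rangle=\sum_{x\in S}f(x)\nu(x)$, and $\mathrm{Var}_\nu(f)=\langle f^2,\nu\rangle-\langle f,\nu\rangle^2$. Let $(\mu_t)_{t\ge 0}$ be probability measures on $S$ of the form $\mu_t(x)=Z_t^{-1}e^{-\mathcal U_t(x)}\mu_0(x)$, where $Z_t$ is the normalization constant and $t\mapsto \mathcal U_t(x)$ is continuously differentiable on $[0,\infty)$ for every $x\in S$. Put $H_t(x)=-\frac{\partial}{\partial t}\log\mu_t(x)$ (with $H_t(x)=0$ if $\mu_0(x)=0$). Let $\mathcal L_t$, $t\ge 0$, be generators ($Q$-matrices) on $S$, with $t\mapsto\mathcal L_t$ continuous, satisfying detailed balance $\mu_t(x)\mathcal L_t(x,y)=\mu_t(y)\mathcal L_t(y,x)$, and let $t\mapsto\lambda_t\ge 0$ be continuous on $[0,\infty)$. For a function $f:S\to\mathbb R$ and $0\le s\le t$ let $q_{s,t}f$ be the unique solution of $$-\frac{\partial}{\partial s}q_{s,t}f=\lambda_s\mathcal L_s q_{s,t}f-H_s\,q_{s,t}f,\quad s\in[0,t],\qquad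 q_{t,t}f=f.$$ For an integer $N\ge 1$ let $(X^N_t)_{t\ge 0}$ be a right continuous time-inhomogeneous Markov process on $S^N$ with initial distribution $\mu_0^N$ (the $N$-fold product measure) and with generator at time $t$ $$\mathcal L^N_t\varphi(x)=\lambda_t\sum_{i=1}^N\mathcal L_t^{(i)}\varphi(x)+\frac1N\sum_{i,j=1}^N\big(H_t(x_i)-H_t(x_j)\big)^+\big(\varphi(x^{i\to j})-\varphi(x)\big),$$ where $\mathcal L_t^{(i)}$ is $\mathcal L_t$ acting on the $i$-th component and $x^{i\to j}$ is $x$ with $x_i$ replaced by $x_j$. Let $$\eta^N_t=\frac1N\sum_{i=1}^N\delta_{X^N_{t,i}},\qquad \nu^N_t=\exp\Big(-\int_0^t\langle H_r,\eta^N_r\rangle\,dr\Big)\,\eta^N_t .$$ Then for all $f:S\to\mathbb R$ and $t\ge 0$, $$\mathbb E\big[\langle f,\nu^N_t\rangle\big]=\langle f,\mu_t\rangle$$ and $$\mathbb E\Big[\big|\langle f,\nu^N_t\rangle-\langle f,\mu_t\rangle\big|^2\Big]=\frac1N\mathrm{Var}_{\mu_t}(f)+\frac1N\int_0^t\mathbb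 E\big[V^N_{s,t}(f)\big]\,ds,$$ where $$\begin{aligned}V^N_{s,t}(f)={}&-\langle H_s(q_{s,t}f)^2,\nu^N_s\rangle\,\langle 1,\nu^N_s\rangle-\langle H_s,\nu^N_s\rangle\,\langle q_{s,t}(f^2)-(q_{s,t}f)^2,\nu^N_s\rangle\\&+\frac12\sum_{y,z\in S}|H_s(z)-H_s(y)|\,\big(q_{s,t}f(z)-q_{s,t}f(y)\big)^2\,\nu^N_s(y)\,\nu^N_s(z);\end{aligned}$$ all expectations and the time integral are of integrable functions. -/

import Mathlib

open MeasureTheory Set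
open scoped Matrix

noncomputable section

namespace ParticleSystem

/-! ### Measures on a finite set and their evolution

A (finite, positive) measure on the finite set `S` is given by its masses `x ↦ ν x`. -/

section Measures

variable {S : Type*} [Fintype S]

/-- The integral `⟨f, ν⟩ = ∑ x, f x * ν x` of `f` with respect to the measure with masses `ν`. -/
def pairing (f ν : S → ℝ) : ℝ := ∑ x, f x * ν x

/-- `Var_ν(f) = ⟨f², ν⟩ - ⟨f, ν⟩²`. -/
def var (ν f : S → ℝ) : ℝ := pairing (f ^ 2) ν - pairing f ν ^ 2

/-- `(μ_t)_{t ≥ 0}` is a family of probability measures of the form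
`μ_t(x) = Z_t⁻¹ exp(-U_t(x)) μ_0(x)`, where `Z_t` is the normalization constant and `U` is
continuously differentiable in time on `[0, ∞)`. -/
structure IsGibbsFamily (U : ℝ → S → ℝ) (μ : ℝ → S → ℝ) : Prop where
  initial_nonneg : ∀ x, 0 ≤ μ 0 x
  initial_sum : ∑ x, μ 0 x = 1
  contDiff : ∀ x, ContDiffOn ℝ 1 (fun t => U t x) (Ici 0)
  eq_gibbs : ∀ t, 0 ≤ t → ∀ x,
    μ t x = (∑ y, Real.exp (-U t y) * μ 0 y)⁻¹ * Real.exp (-U t x) * μ 0 x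

/-- The negative logarithmic time derivative `H_t(x) = -(∂/∂t) log μ_t(x)`, `t ≥ 0` (one-sided at
`t = 0`). At a point that has mass `0` for all the (mutually absolutely continuous) measures `μ_t`
its value is `0`, since `Real.log 0 = 0`. -/
def negLogDeriv (μ : ℝ → S → ℝ) (t : ℝ) (x : S) : ℝ :=
  -derivWithin (fun r => Real.log (μ r x)) (Ici 0) t

/-- `Q` is a generator (`Q`-matrix) of a continuous time Markov chain on `S`. -/
structure IsQMatrix (Q : Matrix S S ℝ) : Prop where
  offDiag_nonneg : ∀ x y, x ≠ y → 0 ≤ Q x y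
  row_sum : ∀ x, ∑ y, Q x y = 0

/-- Detailed balance of `Q` with respect to the measure `ν`. -/
def DetailedBalance (ν : S → ℝ) (Q : Matrix S S ℝ) : Prop :=
  ∀ x y, ν x * Q x y = ν y * Q y x

end Measures

/-! ### The Feynman-Kac propagator -/

section Propagator

variable {S : Type*} [Fintype S]

/-- `s ↦ g s`, `s ∈ [0, t]`, solves the backward equation
`-(∂/∂s) g_s = λ_s L_s g_s - H_s g_s` with terminal condition `g_t = f`. -/
def IsBackwardSolution (lam : ℝ → ℝ) (L : ℝ → Matrix S S ℝ) (H : ℝ → S → ℝ) (t : ℝ) (f : S → ℝ)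
    (g : ℝ → S → ℝ) : Prop :=
  g t = f ∧ ∀ s ∈ Icc 0 t, ∀ x,
    HasDerivWithinAt (fun r => g r x) (-(lam s * (L s *ᵥ g s) x - H s x * g s x)) (Icc 0 t) s

open scoped Classical in
/-- The Feynman-Kac propagator: `propagator lam L H s t f`, for `0 ≤ s ≤ t`, is the value `q_{s,t} f`
at time `s` of the solution of the backward equation on `[0, t]` with terminal condition `f`.
Existence and uniqueness of the solution are proved below (for continuous coefficients), so that
the value `0` is never used there. -/
def propagator (lam : ℝ → ℝ) (L : ℝ → Matrix S S ℝ) (H : ℝ → S → ℝ) (s t : ℝ) (f : S → ℝ) :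
    S → ℝ :=
  if h : ∃ g, IsBackwardSolution lam L H t f g then h.choose s else 0

/-- The right-hand side of the backward equation, written as `(∂/∂s) g = backwardField s g`. -/
def backwardField (lam : ℝ → ℝ) (L : ℝ → Matrix S S ℝ) (H : ℝ → S → ℝ) (s : ℝ) (g : S → ℝ) :
    S → ℝ :=
  fun x => -(lam s * (L s *ᵥ g) x - H s x * g x)

theorem exists_norm_backwardField_le {lam : ℝ → ℝ} {L : ℝ → Matrix S S ℝ} {H : ℝ → S → ℝ} {t : ℝ}
    (hlam : ContinuousOn lam (Icc 0 t)) (hL : ContinuousOn L (Icc 0 t))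
    (hH : ContinuousOn H (Icc 0 t)) :
    ∃ K : NNReal, ∀ s ∈ Icc 0 t, ∀ g : S → ℝ, ‖backwardField lam L H s g‖ ≤ K * ‖g‖ := by
  have hc : ContinuousOn (fun s => |lam s| * ∑ x, ∑ y, |L s x y| + ∑ x, |H s x|) (Icc 0 t) := by
    refine (hlam.abs.mul (continuousOn_finsetSum _ fun x _ => continuousOn_finsetSum _ fun y _ =>
      ContinuousOn.abs ?_)).add (continuousOn_finsetSum _ fun x _ => ContinuousOn.abs ?_)
    · exact (continuous_apply_apply x y).comp_continuousOn hL
    · exact (continuous_apply x).comp_continuousOn hH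
  obtain ⟨C, hC⟩ := isCompact_Icc.exists_bound_of_continuousOn hc
  refine ⟨C.toNNReal, fun s hs g => ?_⟩
  have hCs := (le_abs_self _).trans (hC s hs)
  have hCC : C ≤ C.toNNReal := Real.le_coe_toNNReal C
  refine (pi_norm_le_iff_of_nonneg (by positivity)).2 fun x => ?_
  have h1 : |(L s *ᵥ g) x| ≤ (∑ x, ∑ y, |L s x y|) * ‖g‖ := by
    calc |(L s *ᵥ g) x| ≤ ∑ y, |L s x y * g y| := Finset.abs_sum_le_sum_abs _ _
      _ ≤ ∑ y, |L s x y| * ‖g‖ := by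
          refine Finset.sum_le_sum fun y _ => ?_
          rw [abs_mul]
          exact mul_le_mul_of_nonneg_left (norm_le_pi_norm g y) (abs_nonneg _)
      _ = (∑ y, |L s x y|) * ‖g‖ := (Finset.sum_mul _ _ _).symm
      _ ≤ _ := mul_le_mul_of_nonneg_right (Finset.single_le_sum
          (f := fun x => ∑ y, |L s x y|)
          (fun x _ => Finset.sum_nonneg fun y _ => abs_nonneg _) (Finset.mem_univ x))
          (norm_nonneg _)
  have h2 : |H s x| ≤ ∑ x, |H s x| :=
    Finset.single_le_sum (f := fun x => |H s x|) (fun x _ => abs_nonneg _) (Finset.mem_univ x)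
  calc ‖backwardField lam L H s g x‖ = |lam s * (L s *ᵥ g) x - H s x * g x| := by
        simp only [backwardField, Real.norm_eq_abs, abs_neg]
    _ ≤ |lam s * (L s *ᵥ g) x| + |H s x * g x| := abs_sub _ _
    _ = |lam s| * |(L s *ᵥ g) x| + |H s x| * |g x| := by rw [abs_mul, abs_mul]
    _ ≤ |lam s| * ((∑ x, ∑ y, |L s x y|) * ‖g‖) + (∑ x, |H s x|) * ‖g‖ := by
        refine add_le_add (mul_le_mul_of_nonneg_left h1 (abs_nonneg _))
          (mul_le_mul h2 (norm_le_pi_norm g x) (abs_nonneg _) ?_)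
        exact Finset.sum_nonneg fun x _ => abs_nonneg _
    _ = (|lam s| * (∑ x, ∑ y, |L s x y|) + ∑ x, |H s x|) * ‖g‖ := by ring
    _ ≤ C.toNNReal * ‖g‖ := mul_le_mul_of_nonneg_right (hCs.trans hCC) (norm_nonneg _)

theorem backwardField_sub (lam : ℝ → ℝ) (L : ℝ → Matrix S S ℝ) (H : ℝ → S → ℝ) (s : ℝ)
    (g g' : S → ℝ) :
    backwardField lam L H s g - backwardField lam L H s g' = backwardField lam L H s (g - g') := by
  funext x
  simp only [backwardField, Pi.sub_apply, Matrix.mulVec_sub]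
  ring

theorem isBackwardSolution_iff {lam : ℝ → ℝ} {L : ℝ → Matrix S S ℝ} {H : ℝ → S → ℝ} {t : ℝ}
    {f : S → ℝ} {g : ℝ → S → ℝ} :
    IsBackwardSolution lam L H t f g ↔ g t = f ∧ ∀ s ∈ Icc 0 t,
      HasDerivWithinAt g (backwardField lam L H s (g s)) (Icc 0 t) s := by
  simp only [IsBackwardSolution, hasDerivWithinAt_pi, backwardField]

/-- Uniqueness for the backward equation. -/
theorem IsBackwardSolution.eqOn {lam : ℝ → ℝ} {L : ℝ → Matrix S S ℝ} {H : ℝ → S → ℝ} {t : ℝ}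
    {f : S → ℝ} {g g' : ℝ → S → ℝ}
    (hlam : ContinuousOn lam (Icc 0 t)) (hL : ContinuousOn L (Icc 0 t))
    (hH : ContinuousOn H (Icc 0 t))
    (hg : IsBackwardSolution lam L H t f g) (hg' : IsBackwardSolution lam L H t f g') :
    EqOn g g' (Icc 0 t) := by
  obtain ⟨K, hK⟩ := exists_norm_backwardField_le hlam hL hH
  rw [isBackwardSolution_iff] at hg hg'
  have key : ∀ g : ℝ → S → ℝ, (∀ s ∈ Icc 0 t,
      HasDerivWithinAt g (backwardField lam L H s (g s)) (Icc 0 t) s) → ∀ s ∈ Ioc 0 t,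
      HasDerivWithinAt g (backwardField lam L H s (g s)) (Iic s) s := fun g h s hs =>
    (h s ⟨hs.1.le, hs.2⟩).mono_of_mem_nhdsWithin
      (Filter.mem_of_superset (Icc_mem_nhdsLE hs.1) (Icc_subset_Icc_right hs.2))
  refine ODE_solution_unique_of_mem_Icc_left (v := backwardField lam L H) (s := fun _ => univ)
    (K := K) (fun s hs => ?_) (fun s hs => (hg.2 s hs).continuousWithinAt) (key g hg.2)
    (fun _ _ => mem_univ _) (fun s hs => (hg'.2 s hs).continuousWithinAt) (key g' hg'.2)
    (fun _ _ => mem_univ _) (hg.1.trans hg'.1.symm)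
  refine LipschitzOnWith.of_dist_le_mul fun a _ b _ => ?_
  rw [dist_eq_norm, dist_eq_norm, backwardField_sub]
  exact hK s ⟨hs.1.le, hs.2⟩ _

/-- Existence for the backward equation: the equation with a truncated, bounded right-hand side has
a solution on all of `[0, t]`, and the truncation does not act along it. -/
theorem exists_isBackwardSolution {lam : ℝ → ℝ} {L : ℝ → Matrix S S ℝ} {H : ℝ → S → ℝ} {t : ℝ}
    (ht : 0 ≤ t)
    (hlam : ContinuousOn lam (Icc 0 t)) (hL : ContinuousOn L (Icc 0 t))
    (hH : ContinuousOn H (Icc 0 t)) (f : S → ℝ) :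
    ∃ g, IsBackwardSolution lam L H t f g := by
  obtain ⟨K, hK⟩ := exists_norm_backwardField_le hlam hL hH
  set R : ℝ := gronwallBound ‖f‖ K 0 t with hR
  have hR' : R = ‖f‖ * Real.exp (K * t) := by rw [hR, gronwallBound_ε0]
  have hR0 : 0 ≤ R := by rw [hR']; positivity
  let c : (S → ℝ) → S → ℝ := fun v x => max (-R) (min (v x) R)
  have hcR : ∀ v, ‖c v‖ ≤ R := fun v => (pi_norm_le_iff_of_nonneg hR0).2 fun x =>
    abs_le.2 ⟨le_max_left _ _, max_le (by linarith) (min_le_right _ _)⟩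
  have hcv : ∀ v, ‖c v‖ ≤ ‖v‖ := fun v => (pi_norm_le_iff_of_nonneg (norm_nonneg _)).2 fun x => by
    have h1 := abs_le.1 (norm_le_pi_norm v x)
    refine abs_le.2 ⟨le_max_of_le_right (le_min h1.1 ?_), max_le ?_ ((min_le_left _ _).trans h1.2)⟩
    · linarith [norm_nonneg v]
    · linarith [norm_nonneg v]
  have hcl : ∀ v w, ‖c v - c w‖ ≤ ‖v - w‖ := fun v w =>
    (pi_norm_le_iff_of_nonneg (norm_nonneg _)).2 fun x => by
      refine le_trans ?_ (norm_le_pi_norm (v - w) x)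
      simp only [c, Pi.sub_apply, Real.norm_eq_abs]
      exact (abs_max_sub_max_le_max _ _ _ _).trans (max_le (by simp) <|
        (abs_min_sub_min_le_max _ _ _ _).trans (max_le le_rfl (by simp)))
  have hcid : ∀ v, ‖v‖ ≤ R → c v = v := fun v hv => funext fun x => by
    have h1 := abs_le.1 ((norm_le_pi_norm v x).trans hv)
    simp only [c]
    rw [min_eq_left h1.2, max_eq_right h1.1]
  have hPL : IsPicardLindelof (fun s v => backwardField lam L H s (c v)) (tmin := 0) (tmax := t)
      ⟨t, ht, le_rfl⟩ f (K * R.toNNReal * t.toNNReal) 0 (K * R.toNNReal) K := by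
    refine ⟨fun s hs => LipschitzOnWith.of_dist_le_mul fun a _ b _ => ?_, fun v _ => ?_,
      fun s hs v _ => ?_, ?_⟩
    · rw [dist_eq_norm, dist_eq_norm, backwardField_sub]
      exact (hK s hs _).trans (mul_le_mul_of_nonneg_left (hcl a b) K.2)
    · refine continuousOn_pi.2 fun x => ?_
      refine ((hlam.mul ?_).sub (((continuous_apply x).comp_continuousOn hH).mul
        continuousOn_const)).neg
      exact continuousOn_finsetSum _ fun y _ =>
        ((continuous_apply_apply x y).comp_continuousOn hL).mul continuousOn_const
    · refine (hK s hs _).trans ?_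
      rw [NNReal.coe_mul, Real.coe_toNNReal R hR0]
      exact mul_le_mul_of_nonneg_left (hcR v) K.2
    · simp [ht]
  obtain ⟨g, hg, hg'⟩ := hPL.exists_eq_forall_mem_Icc_hasDerivWithinAt₀
  refine ⟨g, isBackwardSolution_iff.2 ⟨hg, fun s hs => ?_⟩⟩
  suffices h : ‖g s‖ ≤ R by
    have := hg' s hs
    rwa [hcid _ h] at this
  have hmaps : ∀ u ∈ Icc 0 t, t - u ∈ Icc 0 t := fun u hu =>
    ⟨by linarith [hu.2], by linarith [hu.1]⟩
  have hd : ∀ u ∈ Icc 0 t, HasDerivWithinAt (fun u => g (t - u))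
      (-backwardField lam L H (t - u) (c (g (t - u)))) (Icc 0 t) u := fun u hu => by
    have := (hg' (t - u) (hmaps u hu)).scomp u
      ((hasDerivWithinAt_id u (Icc 0 t)).const_sub t) (fun r hr => hmaps r hr)
    simpa [Function.comp_def] using this
  have hgr := norm_le_gronwallBound_of_norm_deriv_right_le (f := fun u => g (t - u))
    (f' := fun u => -backwardField lam L H (t - u) (c (g (t - u)))) (δ := ‖f‖) (K := K) (ε := 0)
    (a := 0) (b := t) (fun u hu => (hd u hu).continuousWithinAt)
    (fun u hu => (hd u ⟨hu.1, hu.2.le⟩).mono_of_mem_nhdsWithin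
      (Filter.mem_of_superset (Icc_mem_nhdsGE hu.2) (Icc_subset_Icc_left hu.1)))
    (by simp [hg])
    (fun u hu => by
      rw [norm_neg, add_zero]
      exact (hK _ (hmaps u ⟨hu.1, hu.2.le⟩) _).trans (mul_le_mul_of_nonneg_left (hcv _) K.2))
    (t - s) (hmaps s hs)
  simp only [sub_sub_cancel, sub_zero] at hgr
  refine hgr.trans ?_
  rw [gronwallBound_ε0, hR']
  have : t - s ≤ t := by linarith [hs.1]
  gcongr

/-- The propagator is the unique solution of the backward equation. -/
theorem isBackwardSolution_propagator {lam : ℝ → ℝ} {L : ℝ → Matrix S S ℝ} {H : ℝ → S → ℝ} {t : ℝ}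
    (ht : 0 ≤ t)
    (hlam : ContinuousOn lam (Icc 0 t)) (hL : ContinuousOn L (Icc 0 t))
    (hH : ContinuousOn H (Icc 0 t)) (f : S → ℝ) :
    IsBackwardSolution lam L H t f (fun s => propagator lam L H s t f) := by
  have h := exists_isBackwardSolution ht hlam hL hH f
  have : (fun s => propagator lam L H s t f) = h.choose := by
    funext s
    simp only [propagator, dif_pos h]
  rw [this]
  exact h.choose_spec

end Propagator

/-! ### Markov processes -/

section Markov

variable {E Ω : Type*} [Fintype E] [DecidableEq E]

/-- `p` is a transition function on the finite set `E` with generators `G t`: the matrices `p s t`,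
`0 ≤ s ≤ t`, are stochastic and solve the forward equation `(∂/∂t) p_{s,t} φ = p_{s,t} G_t φ`,
`p_{s,s} φ = φ`. -/
structure IsTransitionFunction (G : ℝ → (E → ℝ) → E → ℝ) (p : ℝ → ℝ → Matrix E E ℝ) : Prop where
  nonneg : ∀ s t, 0 ≤ s → s ≤ t → ∀ x y, 0 ≤ p s t x y
  row_sum : ∀ s t, 0 ≤ s → s ≤ t → ∀ x, ∑ y, p s t x y = 1
  refl : ∀ s, 0 ≤ s → p s s = 1
  forward : ∀ s t, 0 ≤ s → s ≤ t → ∀ (φ : E → ℝ) (x : E),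
    HasDerivWithinAt (fun r => (p s r *ᵥ φ) x) ((p s t *ᵥ G t φ) x) (Ici s) t

/-- The `σ`-algebra generated by `X_r`, `r ∈ [0, s]`. -/
@[reducible] def past [MeasurableSpace E] (X : ℝ → Ω → E) (s : ℝ) : MeasurableSpace Ω :=
  ⨆ r ∈ Icc 0 s, MeasurableSpace.comap (X r) inferInstance

/-- `(X_t)_{t ≥ 0}` is a right continuous time-inhomogeneous Markov process on the finite set `E`
under `P`, with generator `G t` at time `t`. -/
structure IsMarkovProcess [MeasurableSpace E] [TopologicalSpace E] [MeasurableSpace Ω]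
    (G : ℝ → (E → ℝ) → E → ℝ) (X : ℝ → Ω → E) (P : Measure Ω) : Prop where
  measurable : ∀ t, 0 ≤ t → Measurable (X t)
  right_cont : ∀ ω t, 0 ≤ t → ContinuousWithinAt (fun r => X r ω) (Ici t) t
  markov : ∃ p : ℝ → ℝ → Matrix E E ℝ, IsTransitionFunction G p ∧
    ∀ s t, 0 ≤ s → s ≤ t → ∀ φ : E → ℝ,
      P[fun ω => φ (X t ω) | past X s] =ᵐ[P] fun ω => (p s t *ᵥ φ) (X s ω)

end Markov

/-! ### The interacting particle system -/

section Particles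

variable {S : Type*} [Fintype S] [DecidableEq S] {N : ℕ}

/-- The generator `L_t^N` of the particle system:
`λ_t ∑ i, L_t^{(i)} φ (x) + N⁻¹ ∑ i j, (H_t(x_i) - H_t(x_j))⁺ (φ(x^{i → j}) - φ(x))`. -/
def particleGenerator (lam : ℝ → ℝ) (L : ℝ → Matrix S S ℝ) (H : ℝ → S → ℝ) (t : ℝ)
    (φ : (Fin N → S) → ℝ) (x : Fin N → S) : ℝ :=
  lam t * ∑ i, ∑ y, L t (x i) y * φ (Function.update x i y)
    + (1 / (N : ℝ)) * ∑ i, ∑ j,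
        max (H t (x i) - H t (x j)) 0 * (φ (Function.update x i (x j)) - φ x)

/-- The empirical measure `N⁻¹ ∑ i, δ_{x_i}` of a configuration. -/
def empirical (x : Fin N → S) (y : S) : ℝ := (1 / (N : ℝ)) * ∑ i, if x i = y then 1 else 0

/-- The reweighted empirical measure `ν_t^N = exp(-∫_0^t ⟨H_r, η_r^N⟩ dr) η_t^N` along a path `w`
of the particle system. -/
def reweighted (H : ℝ → S → ℝ) (w : ℝ → Fin N → S) (t : ℝ) (y : S) : ℝ :=
  Real.exp (-∫ r in (0 : ℝ)..t, pairing (H r) (empirical (w r))) * empirical (w t) y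

/-- The expression `V_{s,t}(f)` evaluated at a measure `ν`; the random variable `V_{s,t}^N(f)` is its
value at `ν = ν_s^N`. -/
def varianceRate (lam : ℝ → ℝ) (L : ℝ → Matrix S S ℝ) (H : ℝ → S → ℝ) (s t : ℝ) (f : S → ℝ)
    (ν : S → ℝ) : ℝ :=
  -pairing (H s * propagator lam L H s t f ^ 2) ν * pairing 1 ν
    - pairing (H s) ν * pairing (propagator lam L H s t (f ^ 2) - propagator lam L H s t f ^ 2) ν
    + (1 / 2) * ∑ z, ∑ y, |H s z - H s y|
        * (propagator lam L H s t f z - propagator lam L H s t f y) ^ 2 * ν y * ν z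

end Particles

end ParticleSystem

end

/-! Weight the particle system by `exp(-c ∫ ⟨H, η⟩)` and differentiate `E[weight * φ_s(X_s)]` in
`s`. The Feynman-Kac formula `IsMarkovProcess.integral_weightedMean` says that the derivative is the
weighted mean of `∂φ + Gφ - kφ`, with `k = c⟨H, η⟩`. Both claims follow from a good choice of `φ`;
write `g = q_{s,t}f` and `q = q_{s,t}(f²)`.

For the mean take `c = 1` and `φ = ⟨g, η⟩`. Selection contributes `⟨H, η⟩⟨g, η⟩ - ⟨Hg, η⟩` to the
generator: the weight removes the nonlinear term, and the backward equation removes the rest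
(`backward_pairing_generator`). So the weighted mean is constant in `s`, equal to `⟨g_0, μ_0⟩`. This
is `⟨f, μ_t⟩`, since `∂μ = -Hμ` and detailed balance make `⟨g_s, μ_s⟩` constant.

For the second moment take `c = 2`, because `⟨f, ν⟩²` carries the squared weight. Besides the
first-order terms, the generator on `⟨g, η⟩²` yields a carré du champ of order `1/N`, a mutation
part plus a selection part. The correction `(1/N)⟨q - g², η⟩` is added to `φ`: its evolution cancels
the mutation part, and what remains is `V/N` (`backward_pairing_sq_generator`). The correction
vanishes at `s = t`, and at `s = 0` it turns the sampling variance `Var_{μ_0}(g_0)/N` into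
`Var_{μ_t}(f)/N`. -/

namespace ParticleSystem

/-! ### Feynman-Kac formula for a Markov process on a finite set. -/

section FeynmanKac

open Filter Topology

/-- A real process with right continuous paths is jointly measurable. -/
theorem measurable_uncurry_of_rightContinuous {Ω : Type*} [MeasurableSpace Ω] {Z : ℝ → Ω → ℝ}
    (hm : ∀ r, Measurable (Z r))
    (hc : ∀ ω r, ContinuousWithinAt (fun r => Z r ω) (Ici r) r) :
    Measurable (fun p : Ω × ℝ => Z p.2 p.1) := by
  -- Approximate the time `r` from the right by the grid point `(⌊(n+1)r⌋ + 1)/(n+1)`, which is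
  -- within `1/(n+1)` of `r`. Only countably many times occur for each `n`, and right continuity
  -- gives the limit.
  refine measurable_of_tendsto_metrizable
    (f := fun (n : ℕ) (p : Ω × ℝ) => Z (((⌊((n : ℝ) + 1) * p.2⌋ : ℝ) + 1) / ((n : ℝ) + 1)) p.1)
    (fun n => ?_) (tendsto_pi_nhds.2 fun p => ?_)
  · have h : Measurable (fun p : Ω × ℤ => Z (((p.2 : ℝ) + 1) / ((n : ℝ) + 1)) p.1) :=
      measurable_from_prod_countable_left fun j =>
        hm (((j : ℝ) + 1) / ((n : ℝ) + 1))
    exact h.comp (measurable_fst.prodMk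
      (Int.measurable_floor.comp (measurable_const.mul measurable_snd)))
  · have hlow : ∀ n : ℕ, p.2 ≤ ((⌊((n : ℝ) + 1) * p.2⌋ : ℝ) + 1) / ((n : ℝ) + 1) := fun n => by
      rw [le_div_iff₀ (by positivity)]
      linarith [Int.lt_floor_add_one (((n : ℝ) + 1) * p.2)]
    refine (hc p.1 p.2).tendsto.comp
      (tendsto_nhdsWithin_iff.2 ⟨?_, Eventually.of_forall fun n => hlow n⟩)
    have hup : Tendsto (fun n : ℕ => p.2 + 1 / ((n : ℝ) + 1)) atTop (𝓝 p.2) := by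
      simpa using tendsto_one_div_add_atTop_nhds_zero_nat.const_add p.2
    refine tendsto_of_tendsto_of_tendsto_of_le_of_le tendsto_const_nhds hup hlow fun n => ?_
    have hn : (0 : ℝ) < (n : ℝ) + 1 := by positivity
    have h1 : (p.2 + 1 / ((n : ℝ) + 1)) * ((n : ℝ) + 1) = ((n : ℝ) + 1) * p.2 + 1 := by
      field_simp
    simp only
    rw [div_le_iff₀ hn, h1]
    linarith [Int.floor_le (((n : ℝ) + 1) * p.2)]

theorem abs_exp_neg_sub_exp_neg_le {a b c : ℝ} (ha : -a ≤ c) (hb : -b ≤ c) :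
    |Real.exp (-a) - Real.exp (-b)| ≤ Real.exp c * |a - b| := by
  have key : ∀ a b : ℝ, -a ≤ c → Real.exp (-a) - Real.exp (-b) ≤ Real.exp c * |a - b| := by
    intro a b ha
    have h1 : Real.exp (-b) = Real.exp (-a) * Real.exp (a - b) := by
      rw [← Real.exp_add]; congr 1; ring
    have h2 := Real.add_one_le_exp (a - b)
    have h3 : Real.exp (-a) ≤ Real.exp c := Real.exp_le_exp.2 ha
    calc Real.exp (-a) - Real.exp (-b) = Real.exp (-a) * (1 - Real.exp (a - b)) := by rw [h1]; ring
      _ ≤ Real.exp (-a) * |a - b| := by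
          refine mul_le_mul_of_nonneg_left ?_ (Real.exp_pos _).le
          linarith [neg_le_abs (a - b)]
      _ ≤ _ := mul_le_mul_of_nonneg_right h3 (abs_nonneg _)
  refine abs_le.2 ⟨?_, key a b ha⟩
  have := key b a hb
  rw [abs_sub_comm b a] at this
  linarith

theorem abs_mul_sub_mul_le {a b c d A B α β : ℝ} (hac : |a - c| ≤ α) (hb : |b| ≤ B) (hc : |c| ≤ A)
    (hbd : |b - d| ≤ β) : |a * b - c * d| ≤ α * B + A * β := by
  have h : a * b - c * d = (a - c) * b + c * (b - d) := by ring
  rw [h]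
  refine (abs_add_le _ _).trans (add_le_add ?_ ?_)
  · rw [abs_mul]
    exact mul_le_mul hac hb (abs_nonneg _) ((abs_nonneg _).trans hac)
  · rw [abs_mul]
    exact mul_le_mul hc hbd (abs_nonneg _) ((abs_nonneg _).trans hc)

theorem IsTransitionFunction.norm_mulVec_le {E : Type*} [Fintype E] [DecidableEq E]
    {G : ℝ → (E → ℝ) → E → ℝ} {p : ℝ → ℝ → Matrix E E ℝ}
    (hp : IsTransitionFunction G p) {s r : ℝ} (hs : 0 ≤ s) (hsr : s ≤ r) (φ : E → ℝ) :
    ‖p s r *ᵥ φ‖ ≤ ‖φ‖ := by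
  refine (pi_norm_le_iff_of_nonneg (norm_nonneg _)).2 fun x => ?_
  calc ‖(p s r *ᵥ φ) x‖ ≤ ∑ y, ‖p s r x y * φ y‖ := norm_sum_le _ _
    _ ≤ ∑ y, p s r x y * ‖φ‖ := by
        refine Finset.sum_le_sum fun y _ => ?_
        rw [norm_mul, Real.norm_eq_abs, abs_of_nonneg (hp.nonneg s r hs hsr x y)]
        exact mul_le_mul_of_nonneg_left (norm_le_pi_norm φ y) (hp.nonneg s r hs hsr x y)
    _ = ‖φ‖ := by rw [← Finset.sum_mul, hp.row_sum s r hs hsr x, one_mul]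

/-- Stochastic matrices contract the sup norm, so the forward equation bounds the derivative by `C *
‖φ‖`. This replaces any estimate of jump probabilities. -/
theorem IsTransitionFunction.abs_mulVec_sub_le {E : Type*} [Fintype E] [DecidableEq E]
    {G : ℝ → (E → ℝ) → E → ℝ} {t : ℝ} {p : ℝ → ℝ → Matrix E E ℝ}
    (hp : IsTransitionFunction G p) {C : ℝ} (hC : ∀ s ∈ Icc 0 t, ∀ φ, ‖G s φ‖ ≤ C * ‖φ‖)
    {s r : ℝ} (hs : 0 ≤ s) (hsr : s ≤ r) (hr : r ≤ t) (φ : E → ℝ) (x : E) :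
    |(p s r *ᵥ φ) x - φ x| ≤ C * ‖φ‖ * (r - s) := by
  have h := norm_image_sub_le_of_norm_deriv_right_le_segment
    (f := fun q => (p s q *ᵥ φ) x) (f' := fun q => (p s q *ᵥ G q φ) x) (C := C * ‖φ‖)
    (a := s) (b := r)
    (fun q hq => ((hp.forward s q hs hq.1 φ x).continuousWithinAt).mono Icc_subset_Ici_self)
    (fun q hq => (hp.forward s q hs hq.1 φ x).mono (Ici_subset_Ici.2 hq.1))
    (fun q hq => (norm_le_pi_norm _ x).trans ((hp.norm_mulVec_le hs hq.1 _).trans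
      (hC q ⟨hs.trans hq.1, hq.2.le.trans hr⟩ φ))) r ⟨hsr, le_rfl⟩
  simpa only [hp.refl s hs, Matrix.one_mulVec, Real.norm_eq_abs] using h

theorem measurable_past_comp {E Ω : Type*} [Fintype E] [MeasurableSpace E]
    [MeasurableSingletonClass E] {X : ℝ → Ω → E} {r s : ℝ} (hr : 0 ≤ r) (hrs : r ≤ s) (φ : E → ℝ) :
    Measurable[past X s] fun ω => φ (X r ω) := by
  have h : Measurable[past X s] (X r) := by
    refine Measurable.mono (comap_measurable (X r)) ?_ le_rfl
    exact le_iSup₂_of_le (f := fun r (_ : r ∈ Icc 0 s) =>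
      MeasurableSpace.comap (X r) inferInstance) r ⟨hr, hrs⟩ le_rfl
  exact (measurable_of_finite φ).comp h

variable {E Ω : Type*} [Fintype E] [MeasurableSpace Ω] {P : Measure Ω}

/-- The additive functional `∫_0^s k_r(X_r) dr`. -/
noncomputable def additiveFunctional (k : ℝ → E → ℝ) (X : ℝ → Ω → E) (s : ℝ) (ω : Ω) : ℝ :=
  ∫ r in (0 : ℝ)..s, k r (X r ω)

/-- The exponential weight `exp(-∫_0^s k_r(X_r) dr)`. -/
noncomputable def weight (k : ℝ → E → ℝ) (X : ℝ → Ω → E) (s : ℝ) (ω : Ω) : ℝ :=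
  Real.exp (-additiveFunctional k X s ω)

/-- The weighted expectation `E[exp(-∫_0^s k_r(X_r) dr) φ(X_s)]`. -/
noncomputable def weightedMean (P : Measure Ω) (k : ℝ → E → ℝ) (X : ℝ → Ω → E) (s : ℝ)
    (φ : E → ℝ) : ℝ :=
  ∫ ω, weight k X s ω * φ (X s ω) ∂P

variable [DecidableEq E] [MeasurableSpace E] [TopologicalSpace E]
  {G : ℝ → (E → ℝ) → E → ℝ} {X : ℝ → Ω → E} {k : ℝ → E → ℝ} {t K : ℝ}

theorem IsMarkovProcess.past_le (hX : IsMarkovProcess G X P) (s : ℝ) :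
    past X s ≤ ‹MeasurableSpace Ω› :=
  iSup₂_le fun r hr => (hX.measurable r hr.1).comap_le

theorem IsMarkovProcess.measurable_comp [MeasurableSingletonClass E]
    (hX : IsMarkovProcess G X P) {r : ℝ} (hr : 0 ≤ r)
    (φ : E → ℝ) : Measurable fun ω => φ (X r ω) :=
  (measurable_of_finite φ).comp (hX.measurable r hr)

theorem IsMarkovProcess.eventually_eq [DiscreteTopology E]
    (hX : IsMarkovProcess G X P) (ω : Ω) {s : ℝ} (hs : 0 ≤ s) :
    ∀ᶠ r in 𝓝[≥] s, X r ω = X s ω := by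
  have h := hX.right_cont ω s hs
  rw [ContinuousWithinAt, nhds_discrete, tendsto_pure] at h
  exact h

variable [MeasurableSingletonClass E] [DiscreteTopology E]

/-- Clipping time to `[0, s]` keeps the process measurable with respect to the past of `s`, and
gives a right continuous process indexed by all of `ℝ`. -/
theorem IsMarkovProcess.measurable_uncurry_stopped (hX : IsMarkovProcess G X P)
    (hk : Continuous k) {s : ℝ} (hs : 0 ≤ s) :
    Measurable[(past X s).prod inferInstance]
      fun p : Ω × ℝ => k p.2 (X (max 0 (min p.2 s)) p.1) := by
  have hpath : ∀ ω, ∀ q : ℝ, 0 ≤ q → ∀ᶠ r in 𝓝[≥] q, X r ω = X q ω :=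
    fun ω q hq => hX.eventually_eq ω hq
  let _ : MeasurableSpace Ω := past X s
  refine measurable_uncurry_of_rightContinuous (Z := fun r ω => k r (X (max 0 (min r s)) ω))
    (fun r => ?_) (fun ω r => ?_)
  · exact measurable_past_comp (le_max_left _ _) (max_le hs (min_le_right _ _)) (k r)
  · have hmap : Tendsto (fun r' => max 0 (min r' s)) (𝓝[≥] r) (𝓝[≥] (max 0 (min r s))) := by
      refine tendsto_nhdsWithin_iff.2 ⟨?_, ?_⟩
      · exact ((continuous_const.max (continuous_id.min continuous_const)).tendsto r).mono_left
          nhdsWithin_le_nhds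
      · filter_upwards [self_mem_nhdsWithin] with r' hr'
        exact max_le_max le_rfl (min_le_min (mem_Ici.1 hr') le_rfl)
    have hev := hmap.eventually (hpath ω _ (le_max_left 0 (min r s)))
    refine ContinuousWithinAt.congr_of_eventuallyEq (f := fun r' => k r' (X (max 0 (min r s)) ω))
      ?_ ?_ rfl
    · exact ((continuous_apply _).comp hk).continuousWithinAt
    · filter_upwards [hev] with r' hr'
      rw [hr']

/-- Measurability with respect to `past X s`, not merely the ambient σ-algebra, is what later allows
the weight to be pulled out of a conditional expectation. -/
theorem IsMarkovProcess.stronglyMeasurable_additiveFunctional (hX : IsMarkovProcess G X P)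
    (hk : Continuous k) {s : ℝ} (hs : 0 ≤ s) :
    StronglyMeasurable[past X s] (additiveFunctional k X s) := by
  have h := hX.measurable_uncurry_stopped hk hs
  have h2 : additiveFunctional k X s =
      fun ω => ∫ r in Ioc 0 s, k r (X (max 0 (min r s)) ω) := by
    funext ω
    rw [additiveFunctional, intervalIntegral.integral_of_le hs]
    refine setIntegral_congr_fun measurableSet_Ioc fun r hr => ?_
    simp only [min_eq_left hr.2, max_eq_right hr.1.le]
  rw [h2]
  let _ : MeasurableSpace Ω := past X s
  exact h.stronglyMeasurable.integral_prod_right'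

theorem IsMarkovProcess.stronglyMeasurable_weight (hX : IsMarkovProcess G X P)
    (hk : Continuous k) {s : ℝ} (hs : 0 ≤ s) :
    StronglyMeasurable[past X s] (weight k X s) := by
  have h : Measurable[past X s] (weight k X s) :=
    Real.measurable_exp.comp (hX.stronglyMeasurable_additiveFunctional hk hs).measurable.neg
  exact h.stronglyMeasurable

theorem IsMarkovProcess.measurable_path (hX : IsMarkovProcess G X P) (hk : Continuous k) (ω : Ω)
    {s : ℝ} (hs : 0 ≤ s) :
    Measurable fun r => k r (X (max 0 (min r s)) ω) := by
  have h := hX.measurable_uncurry_stopped hk hs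
  let _ : MeasurableSpace Ω := past X s
  exact h.comp measurable_prodMk_left

theorem IsMarkovProcess.integrableOn_path (hX : IsMarkovProcess G X P) (hk : Continuous k)
    (ω : Ω) (t : ℝ) : IntegrableOn (fun r => k r (X r ω)) (Icc 0 t) := by
  rcases lt_or_ge t 0 with ht | ht
  · simp [Icc_eq_empty ht.not_ge]
  obtain ⟨K, hK⟩ := isCompact_Icc.exists_bound_of_continuousOn (s := Icc 0 t) hk.continuousOn
  have h1 : IntegrableOn (fun r => k r (X (max 0 (min r t)) ω)) (Icc 0 t) := by
    refine Measure.integrableOn_of_bounded (M := K) (by simp)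
      (hX.measurable_path hk ω ht).aestronglyMeasurable ?_
    filter_upwards [ae_restrict_mem measurableSet_Icc] with r hr
    exact (norm_le_pi_norm (k r) _).trans (hK r hr)
  refine h1.congr_fun (fun r hr => ?_) measurableSet_Icc
  simp only [min_eq_left hr.2, max_eq_right hr.1]

theorem IsMarkovProcess.intervalIntegrable_path (hX : IsMarkovProcess G X P) (hk : Continuous k)
    (ω : Ω) {a b : ℝ} (ha : 0 ≤ a) (hb : 0 ≤ b) :
    IntervalIntegrable (fun r => k r (X r ω)) volume a b := by
  refine ((hX.integrableOn_path hk ω (max a b)).mono_set ?_).intervalIntegrable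
  exact Icc_subset_Icc (le_min ha hb) le_rfl

theorem IsMarkovProcess.abs_additiveFunctional_sub_le (hX : IsMarkovProcess G X P)
    (hk : Continuous k) (hK : ∀ r ∈ Icc 0 t, ‖k r‖ ≤ K) (ω : Ω) {s r : ℝ} (hs : 0 ≤ s)
    (hsr : s ≤ r) (hr : r ≤ t) :
    |additiveFunctional k X r ω - additiveFunctional k X s ω| ≤ K * (r - s) := by
  have h : additiveFunctional k X r ω - additiveFunctional k X s ω
      = ∫ q in s..r, k q (X q ω) := by
    rw [additiveFunctional, additiveFunctional, intervalIntegral.integral_interval_sub_left]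
    · exact hX.intervalIntegrable_path hk ω le_rfl (hs.trans hsr)
    · exact hX.intervalIntegrable_path hk ω le_rfl hs
  rw [h, ← Real.norm_eq_abs, ← abs_of_nonneg (sub_nonneg.2 hsr)]
  refine intervalIntegral.norm_integral_le_of_norm_le_const fun q hq => ?_
  rw [uIoc_of_le hsr] at hq
  exact (norm_le_pi_norm (k q) _).trans (hK q ⟨hs.trans hq.1.le, hq.2.trans hr⟩)

theorem IsMarkovProcess.neg_additiveFunctional_le (hX : IsMarkovProcess G X P)
    (hk : Continuous k) (hK : ∀ r ∈ Icc 0 t, ‖k r‖ ≤ K) (ω : Ω) {s : ℝ} (hs : 0 ≤ s)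
    (hst : s ≤ t) : -additiveFunctional k X s ω ≤ K * t := by
  have h := hX.abs_additiveFunctional_sub_le hk hK ω le_rfl hs hst
  have h0 : additiveFunctional k X 0 ω = 0 := by simp [additiveFunctional]
  have hK0 : 0 ≤ K := (norm_nonneg _).trans (hK s ⟨hs, hst⟩)
  rw [h0, sub_zero, sub_zero] at h
  exact (neg_le_abs _).trans (h.trans (mul_le_mul_of_nonneg_left hst hK0))

theorem IsMarkovProcess.abs_weight_le (hX : IsMarkovProcess G X P)
    (hk : Continuous k) (hK : ∀ r ∈ Icc 0 t, ‖k r‖ ≤ K) (ω : Ω) {s : ℝ} (hs : 0 ≤ s)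
    (hst : s ≤ t) : |weight k X s ω| ≤ Real.exp (K * t) := by
  rw [weight, Real.abs_exp]
  exact Real.exp_le_exp.2 (hX.neg_additiveFunctional_le hk hK ω hs hst)

theorem IsMarkovProcess.abs_weight_sub_le (hX : IsMarkovProcess G X P)
    (hk : Continuous k) (hK : ∀ r ∈ Icc 0 t, ‖k r‖ ≤ K) (ω : Ω) {s r : ℝ} (hs : 0 ≤ s)
    (hsr : s ≤ r) (hr : r ≤ t) :
    |weight k X r ω - weight k X s ω| ≤ Real.exp (K * t) * (K * (r - s)) :=
  (abs_exp_neg_sub_exp_neg_le (hX.neg_additiveFunctional_le hk hK ω (hs.trans hsr) hr)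
    (hX.neg_additiveFunctional_le hk hK ω hs (hsr.trans hr))).trans
    (mul_le_mul_of_nonneg_left (hX.abs_additiveFunctional_sub_le hk hK ω hs hsr hr)
      (Real.exp_pos _).le)

/-- The path may jump, but the integrand `k r (X r ω)` is right continuous, so a right derivative
exists at every time. -/
theorem IsMarkovProcess.hasDerivWithinAt_weight (hX : IsMarkovProcess G X P)
    (hk : Continuous k) (ω : Ω) {s : ℝ} (hs : 0 ≤ s) :
    HasDerivWithinAt (fun r => weight k X r ω) (-(k s (X s ω)) * weight k X s ω) (Ioi s) s := by
  have hA : HasDerivWithinAt (fun r => additiveFunctional k X r ω) (k s (X s ω)) (Ici s) s := by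
    refine intervalIntegral.integral_hasDerivWithinAt_right
      (hX.intervalIntegrable_path hk ω le_rfl hs) (t := Ioi s) ?_ ?_
    · have h := hX.integrableOn_path hk ω (s + 1)
      refine ⟨Ioc s (s + 1), Ioc_mem_nhdsGT (by linarith), ?_⟩
      exact (h.mono_set fun q hq => ⟨hs.trans hq.1.le, hq.2⟩).aestronglyMeasurable
    · refine ContinuousWithinAt.congr_of_eventuallyEq (f := fun r => k r (X s ω)) ?_ ?_ rfl
      · exact ((continuous_apply _).comp hk).continuousWithinAt
      · filter_upwards [nhdsWithin_mono s Ioi_subset_Ici_self (hX.eventually_eq ω hs)] with r hr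
        rw [hr]
  have h := ((hA.mono Ioi_subset_Ici_self).neg).exp
  simpa only [weight, Pi.neg_apply, mul_comm] using h

variable [IsProbabilityMeasure P]

theorem IsMarkovProcess.integrable_weight_mul (hX : IsMarkovProcess G X P)
    (hk : Continuous k) {s r : ℝ} (hs : 0 ≤ s) (hr : 0 ≤ r) (φ : E → ℝ) :
    Integrable (fun ω => weight k X s ω * φ (X r ω)) P := by
  obtain ⟨K, hK⟩ := isCompact_Icc.exists_bound_of_continuousOn (s := Icc 0 s) hk.continuousOn
  have hm : AEStronglyMeasurable (fun ω => weight k X s ω * φ (X r ω)) P :=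
    (((hX.stronglyMeasurable_weight hk hs).mono (hX.past_le s)).measurable.mul
      (hX.measurable_comp hr φ)).aestronglyMeasurable
  refine Integrable.of_bound hm (Real.exp (K * s) * ‖φ‖) (Eventually.of_forall fun ω => ?_)
  rw [norm_mul]
  exact mul_le_mul (hX.abs_weight_le hk hK ω hs le_rfl) (norm_le_pi_norm φ _) (norm_nonneg _)
    (Real.exp_pos _).le

/-- Tower property: the weight up to time `s` is known at time `s`, and the Markov property replaces
`φ (X r)` by `(p s r *ᵥ φ) (X s)`. -/
theorem IsMarkovProcess.integral_weight_mul (hX : IsMarkovProcess G X P)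
    (hk : Continuous k) {p : ℝ → ℝ → Matrix E E ℝ}
    (hp : ∀ s t, 0 ≤ s → s ≤ t → ∀ φ : E → ℝ,
      P[fun ω => φ (X t ω) | past X s] =ᵐ[P] fun ω => (p s t *ᵥ φ) (X s ω))
    {s r : ℝ} (hs : 0 ≤ s) (hsr : s ≤ r) (φ : E → ℝ) :
    ∫ ω, weight k X s ω * φ (X r ω) ∂P = weightedMean P k X s (p s r *ᵥ φ) := by
  have hr := hs.trans hsr
  have hm := hX.past_le s
  have hφ : Integrable (fun ω => φ (X r ω)) P :=
    Integrable.of_bound (hX.measurable_comp hr φ).aestronglyMeasurable ‖φ‖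
      (Eventually.of_forall fun ω => norm_le_pi_norm φ _)
  have h := condExp_mul_of_stronglyMeasurable_left (μ := P) (m := past X s)
    (hX.stronglyMeasurable_weight hk hs) (hX.integrable_weight_mul hk hs hr φ) hφ
  rw [← integral_condExp hm]
  refine integral_congr_ae ?_
  filter_upwards [h, hp s r hs hsr φ] with ω h1 h2
  have h1' : (P[fun ω => weight k X s ω * φ (X r ω) | past X s]) ω
      = weight k X s ω * (P[fun ω => φ (X r ω) | past X s]) ω := h1
  rw [h1', h2]

/-- Increments of the weighted mean, after conditioning on the past. -/
theorem IsMarkovProcess.weightedMean_sub (hX : IsMarkovProcess G X P)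
    (hk : Continuous k) {p : ℝ → ℝ → Matrix E E ℝ}
    (hp : ∀ s t, 0 ≤ s → s ≤ t → ∀ φ : E → ℝ,
      P[fun ω => φ (X t ω) | past X s] =ᵐ[P] fun ω => (p s t *ᵥ φ) (X s ω))
    {s r : ℝ} (hs : 0 ≤ s) (hsr : s ≤ r) (φ ψ : E → ℝ) :
    weightedMean P k X r ψ - weightedMean P k X s φ =
      ∫ ω, ((weight k X r ω * ψ (X r ω) - weight k X s ω * φ (X r ω))
        + weight k X s ω * ((p s r *ᵥ φ) (X s ω) - φ (X s ω))) ∂P := by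
  have hr := hs.trans hsr
  have i1 := hX.integrable_weight_mul hk hr hr ψ
  have i2 := hX.integrable_weight_mul hk hs hr φ
  have i3 := hX.integrable_weight_mul hk hs hs (p s r *ᵥ φ)
  have i4 := hX.integrable_weight_mul hk hs hs φ
  have e := hX.integral_weight_mul hk hp hs hsr φ
  have h1 := integral_add (i1.sub i2) (i3.sub i4)
  rw [integral_sub' i1 i2, integral_sub' i3 i4, e] at h1
  simp_rw [mul_sub]
  refine Eq.trans ?_ h1.symm
  simp only [weightedMean]
  ring

/-- The paths jump, but after conditioning the increment is controlled by those of the weight, of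
`ψ` and of `p s r *ᵥ ψ s`, all of which are small. Two-sided continuity is needed because only right
derivatives of the weighted mean are available. -/
theorem IsMarkovProcess.continuousOn_weightedMean (hX : IsMarkovProcess G X P)
    (hk : Continuous k) {C : ℝ} (hC : ∀ s ∈ Icc 0 t, ∀ φ, ‖G s φ‖ ≤ C * ‖φ‖) {ψ : ℝ → E → ℝ}
    (hψ : ContinuousOn ψ (Icc 0 t)) :
    ContinuousOn (fun s => weightedMean P k X s (ψ s)) (Icc 0 t) := by
  obtain ⟨K, hK⟩ := isCompact_Icc.exists_bound_of_continuousOn (s := Icc 0 t) hk.continuousOn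
  obtain ⟨M, hM⟩ := isCompact_Icc.exists_bound_of_continuousOn (s := Icc 0 t) hψ
  obtain ⟨p, hp, hpX⟩ := hX.markov
  set W := Real.exp (K * t) with hW
  have hW0 : 0 < W := Real.exp_pos _
  have key : ∀ s ∈ Icc 0 t, ∀ r ∈ Icc 0 t, s ≤ r →
      |weightedMean P k X r (ψ r) - weightedMean P k X s (ψ s)|
        ≤ (W * (K * |r - s|) * M + W * ‖ψ r - ψ s‖) + W * (|C| * M * |r - s|) := by
    intro s hs r hr hsr
    rw [hX.weightedMean_sub hk hpX hs.1 hsr, ← Real.norm_eq_abs]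
    have hb := norm_integral_le_of_norm_le_const (μ := P) (C :=
      (W * (K * |r - s|) * M + W * ‖ψ r - ψ s‖) + W * (|C| * M * |r - s|)) (f := fun ω =>
        (weight k X r ω * ψ r (X r ω) - weight k X s ω * ψ s (X r ω))
        + weight k X s ω * ((p s r *ᵥ ψ s) (X s ω) - ψ s (X s ω)))
      (Eventually.of_forall fun ω => ?_)
    · simpa using hb
    · have habs : |r - s| = r - s := abs_of_nonneg (sub_nonneg.2 hsr)
      refine (norm_add_le _ _).trans (add_le_add ?_ ?_)
      · refine abs_mul_sub_mul_le ?_ ?_ ?_ ?_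
        · rw [habs]
          exact hX.abs_weight_sub_le hk hK ω hs.1 hsr hr.2
        · exact (norm_le_pi_norm (ψ r) _).trans (hM r hr)
        · exact hX.abs_weight_le hk hK ω hs.1 hs.2
        · exact norm_le_pi_norm (ψ r - ψ s) _
      · rw [norm_mul]
        refine mul_le_mul (hX.abs_weight_le hk hK ω hs.1 hs.2) ?_ (norm_nonneg _) hW0.le
        refine (hp.abs_mulVec_sub_le hC hs.1 hsr hr.2 _ _).trans ?_
        rw [habs]
        refine mul_le_mul_of_nonneg_right ?_ (sub_nonneg.2 hsr)
        exact mul_le_mul (le_abs_self C) (hM s hs) (norm_nonneg _) (abs_nonneg _)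
  -- Conditioning works only forward in time; the bound is symmetric in `s` and `r`, so the other
  -- order follows.
  have key2 : ∀ s ∈ Icc 0 t, ∀ r ∈ Icc 0 t,
      |weightedMean P k X r (ψ r) - weightedMean P k X s (ψ s)|
        ≤ (W * (K * |r - s|) * M + W * ‖ψ r - ψ s‖) + W * (|C| * M * |r - s|) := by
    intro s hs r hr
    rcases le_total s r with h | h
    · exact key s hs r hr h
    · rw [abs_sub_comm, abs_sub_comm r s, norm_sub_rev]
      exact key r hr s hs h
  intro s hs
  rw [ContinuousWithinAt, tendsto_iff_dist_tendsto_zero]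
  refine squeeze_zero' (Eventually.of_forall fun _ => dist_nonneg)
    (eventually_mem_nhdsWithin.mono fun r hr => key2 s hs r hr) ?_
  have h1 : Tendsto (fun r => |r - s|) (𝓝[Icc 0 t] s) (𝓝 0) := by
    have : Tendsto (fun r => |r - s|) (𝓝 s) (𝓝 |s - s|) :=
      ((continuous_id.sub continuous_const).abs).tendsto s
    rw [sub_self, abs_zero] at this
    exact this.mono_left nhdsWithin_le_nhds
  have h2 : Tendsto (fun r => ‖ψ r - ψ s‖) (𝓝[Icc 0 t] s) (𝓝 0) :=
    tendsto_iff_norm_sub_tendsto_zero.1 (hψ s hs)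
  have h3 := ((((h1.const_mul K).const_mul W).mul_const M).add (h2.const_mul W)).add
    ((h1.const_mul (|C| * M)).const_mul W)
  simpa using h3

/-- The Feynman-Kac equation in differential form. -/
theorem IsMarkovProcess.hasDerivWithinAt_weightedMean (hX : IsMarkovProcess G X P)
    (hk : Continuous k) {C : ℝ} (hC : ∀ s ∈ Icc 0 t, ∀ φ, ‖G s φ‖ ≤ C * ‖φ‖) {φ φ' : ℝ → E → ℝ}
    (hφ : ContinuousOn φ (Icc 0 t)) (hφ' : ContinuousOn φ' (Icc 0 t))
    (hd : ∀ s ∈ Ico 0 t, HasDerivWithinAt φ (φ' s) (Ici s) s) {s : ℝ} (hs : s ∈ Ico 0 t) :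
    HasDerivWithinAt (fun r => weightedMean P k X r (φ r))
      (weightedMean P k X s fun x => φ' s x + G s (φ s) x - k s x * φ s x) (Ioi s) s := by
  obtain ⟨K, hK⟩ := isCompact_Icc.exists_bound_of_continuousOn (s := Icc 0 t) hk.continuousOn
  obtain ⟨M, hM⟩ := isCompact_Icc.exists_bound_of_continuousOn (s := Icc 0 t) hφ
  obtain ⟨M', hM'⟩ := isCompact_Icc.exists_bound_of_continuousOn (s := Icc 0 t) hφ'
  obtain ⟨p, hp, hpX⟩ := hX.markov
  set W := Real.exp (K * t) with hW
  have hW0 : 0 < W := Real.exp_pos _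
  have hIoc : ∀ᶠ r in 𝓝[>] s, r ∈ Ioc s t := Ioc_mem_nhdsGT hs.2
  rw [hasDerivWithinAt_iff_tendsto_slope' self_notMem_Ioi]
  have hlim : Tendsto (fun r => ∫ ω, (r - s)⁻¹ *
      ((weight k X r ω * φ r (X r ω) - weight k X s ω * φ s (X r ω))
        + weight k X s ω * ((p s r *ᵥ φ s) (X s ω) - φ s (X s ω))) ∂P) (𝓝[>] s)
      (𝓝 (weightedMean P k X s fun x => φ' s x + G s (φ s) x - k s x * φ s x)) := by
    refine tendsto_integral_filter_of_dominated_convergence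
      (fun _ => (W * K * M + W * M') + W * (C * ‖φ s‖)) ?_ ?_ (integrable_const _) ?_
    · filter_upwards [hIoc] with r hr
      have hr0 : 0 ≤ r := hs.1.trans hr.1.le
      exact ((((hX.integrable_weight_mul hk hr0 hr0 _).sub
        (hX.integrable_weight_mul hk hs.1 hr0 _)).add
        (hX.integrable_weight_mul hk hs.1 hs.1 (p s r *ᵥ φ s - φ s))).const_mul _
        ).aestronglyMeasurable
    · filter_upwards [hIoc] with r hr
      refine Eventually.of_forall fun ω => ?_
      have hr0 : 0 ≤ r := hs.1.trans hr.1.le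
      have hpos : 0 < r - s := sub_pos.2 hr.1
      rw [norm_mul, norm_inv, Real.norm_eq_abs (r - s), abs_of_pos hpos,
        inv_mul_le_iff₀ hpos]
      have hb1 : |weight k X r ω * φ r (X r ω) - weight k X s ω * φ s (X r ω)|
          ≤ W * (K * (r - s)) * M + W * (M' * (r - s)) := by
        refine abs_mul_sub_mul_le ?_ ?_ ?_ ?_
        · exact hX.abs_weight_sub_le hk hK ω hs.1 hr.1.le hr.2
        · exact (norm_le_pi_norm (φ r) _).trans (hM r ⟨hr0, hr.2⟩)
        · exact hX.abs_weight_le hk hK ω hs.1 hs.2.le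
        · refine (norm_le_pi_norm (φ r - φ s) _).trans ?_
          exact norm_image_sub_le_of_norm_deriv_right_le_segment
            (hφ.mono (Icc_subset_Icc hs.1 hr.2))
            (fun q hq => hd q ⟨hs.1.trans hq.1, hq.2.trans_le hr.2⟩)
            (fun q hq => hM' q ⟨hs.1.trans hq.1, hq.2.le.trans hr.2⟩) r ⟨hr.1.le, le_rfl⟩
      have hb2 : |weight k X s ω * ((p s r *ᵥ φ s) (X s ω) - φ s (X s ω))|
          ≤ W * (C * ‖φ s‖ * (r - s)) := by
        rw [abs_mul]
        exact mul_le_mul (hX.abs_weight_le hk hK ω hs.1 hs.2.le)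
          (hp.abs_mulVec_sub_le hC hs.1 hr.1.le hr.2 _ _) (abs_nonneg _) hW0.le
      refine (abs_add_le _ _).trans ((add_le_add hb1 hb2).trans (le_of_eq ?_))
      ring
    -- For fixed `ω` the state is frozen at `x = X s ω` for `r` close to `s`. Thus the first bracket
    -- yields the derivative of `weight * φ r x`, and the generator enters only through the
    -- derivative of `p s r` in the second.
    · refine Eventually.of_forall fun ω => ?_
      set x := X s ω with hx
      have hφx : HasDerivWithinAt (fun r => φ r x) (φ' s x) (Ioi s) s :=
        (hasDerivWithinAt_pi.1 (hd s hs) x).mono Ioi_subset_Ici_self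
      have d1 := (hX.hasDerivWithinAt_weight hk ω hs.1).mul hφx
      have d2 := ((hp.forward s s hs.1 le_rfl (φ s) x).mono Ioi_subset_Ici_self).const_mul
        (weight k X s ω)
      have d3 := d1.add d2
      rw [hasDerivWithinAt_iff_tendsto_slope' self_notMem_Ioi] at d3
      have hval : -(k s (X s ω)) * weight k X s ω * φ s x + weight k X s ω * φ' s x
          + weight k X s ω * (p s s *ᵥ G s (φ s)) x
          = weight k X s ω * (φ' s x + G s (φ s) x - k s x * φ s x) := by
        rw [hp.refl s hs.1, Matrix.one_mulVec, hx]
        ring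
      rw [hval] at d3
      refine d3.congr' ?_
      filter_upwards [nhdsWithin_mono s Ioi_subset_Ici_self (hX.eventually_eq ω hs.1)] with r hr
      rw [hr, slope_def_module, smul_eq_mul]
      simp only [Pi.add_apply, Pi.mul_apply, hp.refl s hs.1, Matrix.one_mulVec, ← hx]
      ring
  refine hlim.congr' ?_
  filter_upwards [hIoc] with r hr
  rw [slope_def_module, smul_eq_mul, hX.weightedMean_sub hk hpX hs.1 hr.1.le,
    integral_const_mul]

/-- The Feynman-Kac equation in integrated form. -/
theorem IsMarkovProcess.integral_weightedMean (hX : IsMarkovProcess G X P) (ht : 0 ≤ t)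
    (hk : Continuous k) {C : ℝ} (hC : ∀ s ∈ Icc 0 t, ∀ φ, ‖G s φ‖ ≤ C * ‖φ‖)
    {φ φ' ψ : ℝ → E → ℝ}
    (hφ : ContinuousOn φ (Icc 0 t)) (hφ' : ContinuousOn φ' (Icc 0 t))
    (hd : ∀ s ∈ Ico 0 t, HasDerivWithinAt φ (φ' s) (Ici s) s)
    (hψ : ContinuousOn ψ (Icc 0 t))
    (heq : ∀ s ∈ Icc 0 t, ∀ x, φ' s x + G s (φ s) x - k s x * φ s x = ψ s x) :
    ∫ s in (0 : ℝ)..t, weightedMean P k X s (ψ s)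
      = weightedMean P k X t (φ t) - weightedMean P k X 0 (φ 0) := by
  refine intervalIntegral.integral_eq_sub_of_hasDeriv_right_of_le ht
    (hX.continuousOn_weightedMean hk hC hφ) (fun s hs => ?_)
    ((hX.continuousOn_weightedMean hk hC hψ).intervalIntegrable_of_Icc ht)
  have h := hX.hasDerivWithinAt_weightedMean hk hC hφ hφ' hd (s := s) ⟨hs.1.le, hs.2⟩
  rwa [funext (heq s ⟨hs.1.le, hs.2.le⟩)] at h

end FeynmanKac

/-! ### Evolution of the Gibbs measures `μ_t`. -/

section GibbsFamily

variable {S : Type*} [Fintype S] {U μ : ℝ → S → ℝ}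

theorem IsGibbsFamily.partition_pos (hμ : IsGibbsFamily U μ) (t : ℝ) :
    0 < ∑ y, Real.exp (-U t y) * μ 0 y := by
  obtain ⟨y, -, hy⟩ : ∃ y ∈ Finset.univ, 0 < μ 0 y := by
    by_contra! h
    have := Finset.sum_nonpos h
    rw [hμ.initial_sum] at this
    linarith
  exact Finset.sum_pos' (fun x _ => mul_nonneg (Real.exp_pos _).le (hμ.initial_nonneg x))
    ⟨y, Finset.mem_univ y, mul_pos (Real.exp_pos _) hy⟩

theorem IsGibbsFamily.contDiffOn (hμ : IsGibbsFamily U μ) (x : S) :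
    ContDiffOn ℝ 1 (fun t => μ t x) (Ici 0) := by
  have hexp : ∀ y, ContDiffOn ℝ 1 (fun t => Real.exp (-U t y)) (Ici 0) := fun y =>
    (hμ.contDiff y).neg.exp
  have hZ : ContDiffOn ℝ 1 (fun t => ∑ y, Real.exp (-U t y) * μ 0 y) (Ici 0) :=
    ContDiffOn.sum fun y _ => (hexp y).mul contDiffOn_const
  refine (((hZ.inv fun t _ => (hμ.partition_pos t).ne').mul (hexp x)).mul
    contDiffOn_const).congr fun t ht => hμ.eq_gibbs t ht x

theorem IsGibbsFamily.eq_zero (hμ : IsGibbsFamily U μ) {x : S} (hx : μ 0 x = 0) {t : ℝ}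
    (ht : 0 ≤ t) : μ t x = 0 := by
  rw [hμ.eq_gibbs t ht x, hx, mul_zero]

theorem IsGibbsFamily.pos (hμ : IsGibbsFamily U μ) {x : S} (hx : μ 0 x ≠ 0) {t : ℝ}
    (ht : 0 ≤ t) : 0 < μ t x := by
  rw [hμ.eq_gibbs t ht x]
  exact mul_pos (mul_pos (inv_pos.2 (hμ.partition_pos t)) (Real.exp_pos _))
    (lt_of_le_of_ne (hμ.initial_nonneg x) hx.symm)

/-- The support of `μ t` does not depend on `t`: on it the logarithm is `C¹`, and off it `Real.log 0
= 0` makes the function constant. -/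
theorem IsGibbsFamily.continuousOn_negLogDeriv (hμ : IsGibbsFamily U μ) :
    ContinuousOn (negLogDeriv μ) (Ici 0) := by
  refine continuousOn_pi.2 fun x => ?_
  refine ContinuousOn.neg (f := fun t => derivWithin (fun r => Real.log (μ r x)) (Ici 0) t) ?_
  have hC : ContDiffOn ℝ 1 (fun r => Real.log (μ r x)) (Ici 0) := by
    by_cases hx : μ 0 x = 0
    · refine (contDiffOn_const (c := (0 : ℝ))).congr fun t ht => ?_
      rw [hμ.eq_zero hx ht, Real.log_zero]
    · exact (hμ.contDiffOn x).log fun t ht => (hμ.pos hx ht).ne'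
  exact hC.continuousOn_derivWithin (uniqueDiffOn_Ici 0) le_rfl

theorem IsGibbsFamily.hasDerivWithinAt (hμ : IsGibbsFamily U μ) (x : S) {t : ℝ} (ht : 0 ≤ t) :
    HasDerivWithinAt (fun r => μ r x) (-(negLogDeriv μ t x * μ t x)) (Ici 0) t := by
  by_cases hx : μ 0 x = 0
  · rw [hμ.eq_zero hx ht, mul_zero, neg_zero]
    exact (hasDerivWithinAt_const t (Ici 0) (0 : ℝ)).congr
      (fun r hr => hμ.eq_zero hx hr) (hμ.eq_zero hx ht)
  · have h := (((hμ.contDiffOn x).differentiableOn one_ne_zero) t ht).hasDerivWithinAt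
    have hne := (hμ.pos hx ht).ne'
    have hlog := (h.log hne).derivWithin (uniqueDiffOn_Ici (0 : ℝ) t ht)
    have hH : negLogDeriv μ t x = -(derivWithin (fun r => μ r x) (Ici 0) t / μ t x) :=
      congrArg Neg.neg hlog
    have e : -(negLogDeriv μ t x * μ t x) = derivWithin (fun r => μ r x) (Ici 0) t := by
      rw [hH]
      field_simp
    rwa [e]

/-- Reversibility implies invariance: detailed balance moves the mass to the other index, where the
zero row sums apply. -/
theorem DetailedBalance.pairing_mulVec_eq_zero {ν : S → ℝ} {Q : Matrix S S ℝ}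
    (hQ : IsQMatrix Q) (h : DetailedBalance ν Q) (g : S → ℝ) : pairing (Q *ᵥ g) ν = 0 := by
  have h1 : pairing (Q *ᵥ g) ν = ∑ x, ∑ y, ν y * Q y x * g y := by
    refine Finset.sum_congr rfl fun x _ => ?_
    rw [Matrix.mulVec, dotProduct, Finset.sum_mul]
    refine Finset.sum_congr rfl fun y _ => ?_
    rw [← h x y]
    ring
  rw [h1, Finset.sum_comm]
  refine Finset.sum_eq_zero fun y _ => ?_
  rw [← Finset.sum_mul, ← Finset.mul_sum, hQ.row_sum, mul_zero, zero_mul]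

/-- The Feynman-Kac propagator transports `μ_0` to `μ_t`. -/
theorem IsGibbsFamily.pairing_backwardSolution (hμ : IsGibbsFamily U μ) {lam : ℝ → ℝ}
    {L : ℝ → Matrix S S ℝ} (hL_gen : ∀ t, 0 ≤ t → IsQMatrix (L t))
    (hL_db : ∀ t, 0 ≤ t → DetailedBalance (μ t) (L t)) {t : ℝ} (ht : 0 ≤ t) {f : S → ℝ}
    {g : ℝ → S → ℝ} (hg : IsBackwardSolution lam L (negLogDeriv μ) t f g) :
    pairing (g 0) (μ 0) = pairing f (μ t) := by
  -- The two `H` terms, from the backward equation and from `∂μ = -Hμ`, cancel; the remaining `-λ⟨L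
  -- g, μ⟩` vanishes by invariance.
  have hd : ∀ s ∈ Icc 0 t, HasDerivWithinAt (fun r => pairing (g r) (μ r)) 0 (Icc 0 t) s := by
    intro s hs
    have h : HasDerivWithinAt (fun r => pairing (g r) (μ r))
        (∑ x, (-(lam s * (L s *ᵥ g s) x - negLogDeriv μ s x * g s x) * μ s x
          + g s x * -(negLogDeriv μ s x * μ s x))) (Icc 0 t) s :=
      HasDerivWithinAt.fun_sum fun x _ => (hg.2 s hs x).mul
        ((hμ.hasDerivWithinAt x hs.1).mono Icc_subset_Ici_self)
    convert h using 1
    have e : ∑ x, (-(lam s * (L s *ᵥ g s) x - negLogDeriv μ s x * g s x) * μ s x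
        + g s x * -(negLogDeriv μ s x * μ s x)) = -lam s * pairing (L s *ᵥ g s) (μ s) := by
      rw [pairing, Finset.mul_sum]
      exact Finset.sum_congr rfl fun x _ => by ring
    rw [e, (hL_db s hs.1).pairing_mulVec_eq_zero (hL_gen s hs.1), mul_zero]
  have hconst := constant_of_has_deriv_right_zero
    (fun s hs => (hd s hs).continuousWithinAt)
    (fun s hs => (hd s ⟨hs.1, hs.2.le⟩).mono_of_mem_nhdsWithin
      (Filter.mem_of_superset (Icc_mem_nhdsGE hs.2) (Icc_subset_Icc_left hs.1)))
    t ⟨ht, le_rfl⟩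
  rw [hg.1] at hconst
  exact hconst.symm

end GibbsFamily

/-! ### The particle generator on linear and quadratic functionals of the empirical measure. -/

section Generator

variable {S : Type*} [Fintype S]

theorem pairing_sub (f g ν : S → ℝ) : pairing (f - g) ν = pairing f ν - pairing g ν := by
  simp only [pairing, Pi.sub_apply, sub_mul, Finset.sum_sub_distrib]

theorem pairing_smul (c : ℝ) (f ν : S → ℝ) : pairing (c • f) ν = c * pairing f ν := by
  simp only [pairing, Pi.smul_apply, smul_eq_mul, Finset.mul_sum, mul_assoc]

theorem pairing_smul_right (c : ℝ) (f ν : S → ℝ) : pairing f (c • ν) = c * pairing f ν := by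
  simp only [pairing, Pi.smul_apply, smul_eq_mul, Finset.mul_sum]
  exact Finset.sum_congr rfl fun x _ => by ring

theorem IsQMatrix.sum_mul_sub {Q : Matrix S S ℝ} (hQ : IsQMatrix Q) (g : S → ℝ) (x : S) (c : ℝ) :
    ∑ y, Q x y * (g y - c) = (Q *ᵥ g) x := by
  simp only [mul_sub, Finset.sum_sub_distrib]
  rw [← Finset.sum_mul, hQ.row_sum, zero_mul, sub_zero]
  rfl

theorem IsQMatrix.sum_mul_sq_sub {Q : Matrix S S ℝ} (hQ : IsQMatrix Q) (g : S → ℝ) (x : S) :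
    ∑ y, Q x y * (g y - g x) ^ 2 = (Q *ᵥ (g ^ 2)) x - 2 * (g x * (Q *ᵥ g) x) := by
  -- The shifts `0` and `g x / 2` put both terms in the form `Q x y * (_ - c)` of `sum_mul_sub`,
  -- where constants disappear.
  have h : ∀ y, Q x y * (g y - g x) ^ 2
      = Q x y * ((g ^ 2) y - 0) - 2 * (g x * (Q x y * (g y - g x / 2))) := fun y => by
    simp only [Pi.pow_apply]
    ring
  simp only [h, Finset.sum_sub_distrib, ← Finset.mul_sum, hQ.sum_mul_sub]

variable {N : ℕ}

/-- The carré du champ operator of the particle system. -/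
noncomputable def particleCarre (lam : ℝ → ℝ) (L : ℝ → Matrix S S ℝ) (H : ℝ → S → ℝ) (t : ℝ)
    (φ : (Fin N → S) → ℝ) (x : Fin N → S) : ℝ :=
  lam t * ∑ i, ∑ y, L t (x i) y * (φ (Function.update x i y) - φ x) ^ 2
    + (1 / (N : ℝ)) * ∑ i, ∑ j,
        max (H t (x i) - H t (x j)) 0 * (φ (Function.update x i (x j)) - φ x) ^ 2

variable {lam : ℝ → ℝ} {L : ℝ → Matrix S S ℝ} {H : ℝ → S → ℝ} {t : ℝ}

theorem particleGenerator_eq (hL : IsQMatrix (L t)) (φ : (Fin N → S) → ℝ) (x : Fin N → S) :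
    particleGenerator lam L H t φ x
      = lam t * ∑ i, ∑ y, L t (x i) y * (φ (Function.update x i y) - φ x)
      + (1 / (N : ℝ)) * ∑ i, ∑ j,
          max (H t (x i) - H t (x j)) 0 * (φ (Function.update x i (x j)) - φ x) := by
  rw [particleGenerator]
  congr 2
  refine Finset.sum_congr rfl fun i _ => ?_
  exact (hL.sum_mul_sub (fun y => φ (Function.update x i y)) (x i) (φ x)).symm

theorem particleGenerator_add (φ ψ : (Fin N → S) → ℝ) (x : Fin N → S) :
    particleGenerator lam L H t (fun x => φ x + ψ x) x
      = particleGenerator lam L H t φ x + particleGenerator lam L H t ψ x := by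
  have h : ∀ a b c d : ℝ, a + b - (c + d) = (a - c) + (b - d) := fun a b c d => by ring
  simp only [particleGenerator, mul_add, Finset.sum_add_distrib, h]
  ring

theorem particleGenerator_const_mul (c : ℝ) (φ : (Fin N → S) → ℝ) (x : Fin N → S) :
    particleGenerator lam L H t (fun x => c * φ x) x = c * particleGenerator lam L H t φ x := by
  simp only [particleGenerator, ← mul_sub, mul_left_comm _ c, ← Finset.mul_sum]
  ring

/-- Every jump term satisfies `a² - b² = 2b(a - b) + (a - b)²`; the last square produces the carré
du champ. -/
theorem particleGenerator_sq (hL : IsQMatrix (L t)) (φ : (Fin N → S) → ℝ) (x : Fin N → S) :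
    particleGenerator lam L H t (fun x => φ x ^ 2) x
      = 2 * φ x * particleGenerator lam L H t φ x + particleCarre lam L H t φ x := by
  have h : ∀ a b : ℝ, a ^ 2 - b ^ 2 = 2 * b * (a - b) + (a - b) ^ 2 := fun a b => by ring
  rw [particleGenerator_eq hL, particleGenerator_eq hL, particleCarre]
  simp only [h, mul_add, Finset.sum_add_distrib, mul_left_comm _ (2 * φ x), ← Finset.mul_sum]
  ring

/-- Symmetrize in `i` and `j`: since `r⁺ - (-r)⁺ = r`, the positive parts disappear and the double
sum factorizes. -/
theorem sum_max_sub_mul_sub (a b : Fin N → ℝ) :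
    ∑ i, ∑ j, max (a i - a j) 0 * (b j - b i)
      = (∑ i, a i) * ∑ i, b i - N * ∑ i, a i * b i := by
  have hmax : ∀ r : ℝ, max r 0 - max (-r) 0 = r := fun r => by
    rcases le_total 0 r with h | h
    · rw [max_eq_left h, max_eq_right (by linarith)]; ring
    · rw [max_eq_right h, max_eq_left (by linarith)]; ring
  have hsymm : ∑ i, ∑ j, max (a i - a j) 0 * (b j - b i)
      = ∑ i, ∑ j, max (a j - a i) 0 * (b i - b j) := Finset.sum_comm
  have hadd : (∑ i, ∑ j, max (a i - a j) 0 * (b j - b i))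
      + (∑ i, ∑ j, max (a j - a i) 0 * (b i - b j))
      = ∑ i, ∑ j, (a i * b j + a j * b i - a i * b i - a j * b j) := by
    simp only [← Finset.sum_add_distrib]
    refine Finset.sum_congr rfl fun i _ => Finset.sum_congr rfl fun j _ => ?_
    have := hmax (a i - a j)
    rw [neg_sub] at this
    linear_combination (b j - b i) * this
  have hexp : ∑ i, ∑ j, (a i * b j + a j * b i - a i * b i - a j * b j)
      = 2 * ((∑ i, a i) * ∑ i, b i - N * ∑ i, a i * b i) := by
    simp only [Finset.sum_sub_distrib, Finset.sum_add_distrib, ← Finset.mul_sum,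
      ← Finset.sum_mul, Finset.sum_const, Finset.card_univ, Fintype.card_fin, nsmul_eq_mul,
      mul_left_comm _ (N : ℝ)]
    ring
  linarith

/-- The square is even under exchanging `i` and `j`, so here `r⁺ + (-r)⁺ = |r|` applies; this is the
origin of `½|H(z) - H(y)|` in the variance rate. -/
theorem sum_max_sub_mul_sq_sub (a b : Fin N → ℝ) :
    ∑ i, ∑ j, max (a i - a j) 0 * (b j - b i) ^ 2
      = (1 / 2) * ∑ i, ∑ j, |a i - a j| * (b i - b j) ^ 2 := by
  have hmax : ∀ r : ℝ, max r 0 + max (-r) 0 = |r| := fun r => by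
    rcases le_total 0 r with h | h
    · rw [max_eq_left h, max_eq_right (by linarith), abs_of_nonneg h]; ring
    · rw [max_eq_right h, max_eq_left (by linarith), abs_of_nonpos h]; ring
  have hsymm : ∑ i, ∑ j, max (a i - a j) 0 * (b j - b i) ^ 2
      = ∑ i, ∑ j, max (a j - a i) 0 * (b i - b j) ^ 2 := Finset.sum_comm
  have hadd : (∑ i, ∑ j, max (a i - a j) 0 * (b j - b i) ^ 2)
      + (∑ i, ∑ j, max (a j - a i) 0 * (b i - b j) ^ 2)
      = ∑ i, ∑ j, |a i - a j| * (b i - b j) ^ 2 := by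
    simp only [← Finset.sum_add_distrib]
    refine Finset.sum_congr rfl fun i _ => Finset.sum_congr rfl fun j _ => ?_
    have := hmax (a i - a j)
    rw [neg_sub] at this
    linear_combination (b i - b j) ^ 2 * this
  linarith

theorem exists_norm_particleGenerator_le (hlam : ContinuousOn lam (Icc 0 t))
    (hL : ContinuousOn L (Icc 0 t)) (hH : ContinuousOn H (Icc 0 t)) :
    ∃ C : ℝ, ∀ s ∈ Icc 0 t, ∀ φ : (Fin N → S) → ℝ,
      ‖particleGenerator lam L H s φ‖ ≤ C * ‖φ‖ := by
  -- The operator bound at each configuration; the factor `2` comes from `|φ(x^{i→j}) - φ(x)| ≤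
  -- 2‖φ‖`.
  let c : ℝ → (Fin N → S) → ℝ := fun s x => |lam s| * ∑ i, ∑ y, |L s (x i) y|
    + (1 / (N : ℝ)) * ∑ i, ∑ j, max (H s (x i) - H s (x j)) 0 * 2
  have hc : ContinuousOn c (Icc 0 t) := by
    have hLxy : ∀ x y, ContinuousOn (fun s => |L s x y|) (Icc 0 t) := fun x y =>
      ((continuous_apply_apply x y).comp_continuousOn hL).abs
    have hHx : ∀ x, ContinuousOn (fun s => H s x) (Icc 0 t) := fun x =>
      (continuous_apply x).comp_continuousOn hH
    refine continuousOn_pi.2 fun x => ?_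
    refine (hlam.abs.mul (continuousOn_finsetSum _ fun i _ => continuousOn_finsetSum _ fun y _ =>
      hLxy _ _)).add (continuousOn_const.mul (continuousOn_finsetSum _ fun i _ =>
      continuousOn_finsetSum _ fun j _ => ?_))
    exact (((hHx _).sub (hHx _)).sup continuousOn_const).mul continuousOn_const
  obtain ⟨C, hC⟩ := isCompact_Icc.exists_bound_of_continuousOn hc
  refine ⟨C, fun s hs φ => ?_⟩
  have hC0 : 0 ≤ C := (norm_nonneg _).trans (hC s hs)
  refine (pi_norm_le_iff_of_nonneg (by positivity)).2 fun x => ?_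
  refine le_trans ?_ (mul_le_mul_of_nonneg_right
    (((le_abs_self _).trans (norm_le_pi_norm (c s) x)).trans (hC s hs)) (norm_nonneg φ))
  have hφ : ∀ x, |φ x| ≤ ‖φ‖ := fun x => norm_le_pi_norm φ x
  simp only [c, add_mul, mul_assoc, Finset.sum_mul]
  refine (abs_add_le _ _).trans (add_le_add ?_ ?_)
  · rw [abs_mul]
    refine mul_le_mul_of_nonneg_left ?_ (abs_nonneg _)
    refine (Finset.abs_sum_le_sum_abs _ _).trans (Finset.sum_le_sum fun i _ => ?_)
    refine (Finset.abs_sum_le_sum_abs _ _).trans (Finset.sum_le_sum fun y _ => ?_)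
    rw [abs_mul]
    exact mul_le_mul_of_nonneg_left (hφ _) (abs_nonneg _)
  · rw [abs_mul, abs_of_nonneg (by positivity : (0 : ℝ) ≤ 1 / (N : ℝ))]
    refine mul_le_mul_of_nonneg_left ?_ (by positivity)
    refine (Finset.abs_sum_le_sum_abs _ _).trans (Finset.sum_le_sum fun i _ => ?_)
    refine (Finset.abs_sum_le_sum_abs _ _).trans (Finset.sum_le_sum fun j _ => ?_)
    rw [abs_mul, abs_of_nonneg (le_max_right _ _)]
    refine mul_le_mul_of_nonneg_left ?_ (le_max_right _ _)
    linarith [abs_sub (φ (Function.update x i (x j))) (φ x), hφ (Function.update x i (x j)), hφ x]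

variable [DecidableEq S]

theorem pairing_empirical (g : S → ℝ) (x : Fin N → S) :
    pairing g (empirical x) = (1 / (N : ℝ)) * ∑ i, g (x i) := by
  simp only [pairing, empirical, Finset.mul_sum]
  rw [Finset.sum_comm]
  refine Finset.sum_congr rfl fun i _ => ?_
  simp [mul_comm]

theorem pairing_one_empirical (hN : 0 < N) (x : Fin N → S) :
    pairing 1 (empirical x) = 1 := by
  rw [pairing_empirical]
  have : (N : ℝ) ≠ 0 := by positivity
  simp [this]

theorem pairing_empirical_update (g : S → ℝ) (x : Fin N → S) (i : Fin N) (y : S) :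
    pairing g (empirical (Function.update x i y))
      = pairing g (empirical x) + (1 / (N : ℝ)) * (g y - g (x i)) := by
  rw [pairing_empirical, pairing_empirical, ← mul_add]
  congr 1
  have h : ∀ j, g (Function.update x i y j) = g (x j) + if j = i then g y - g (x i) else 0 := by
    intro j
    by_cases hj : j = i
    · subst hj; simp
    · simp [hj]
  simp [h, Finset.sum_add_distrib]

/-- Selection acts as minus the empirical covariance of `H` and `g`. Its nonlinear part `⟨H, η⟩⟨g,
η⟩` is what the exponential weight compensates. -/
theorem particleGenerator_pairing (hN : 0 < N) (hL : IsQMatrix (L t)) (g : S → ℝ)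
    (x : Fin N → S) :
    particleGenerator lam L H t (fun x => pairing g (empirical x)) x
      = lam t * pairing (L t *ᵥ g) (empirical x)
        + pairing (H t) (empirical x) * pairing g (empirical x)
        - pairing (H t * g) (empirical x) := by
  have hN' : (N : ℝ) ≠ 0 := by positivity
  rw [particleGenerator_eq hL]
  simp only [pairing_empirical_update, add_sub_cancel_left, mul_left_comm _ (1 / (N : ℝ)),
    ← Finset.mul_sum, hL.sum_mul_sub]
  rw [sum_max_sub_mul_sub (fun i => H t (x i)) (fun i => g (x i))]
  simp only [pairing_empirical, Pi.mul_apply]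
  field_simp
  ring

/-- One jump changes `⟨g, η⟩` by `1/N` times a difference of `g`; squaring gives `1/N²`, and summing
over the particles leaves the order `1/N`. -/
theorem particleCarre_pairing (hL : IsQMatrix (L t)) (g : S → ℝ)
    (x : Fin N → S) :
    particleCarre lam L H t (fun x => pairing g (empirical x)) x
      = (1 / (N : ℝ)) * (lam t * (pairing (L t *ᵥ (g ^ 2)) (empirical x)
          - 2 * pairing (g * (L t *ᵥ g)) (empirical x))
        + (1 / 2) * ∑ z, ∑ y, |H t z - H t y| * (g z - g y) ^ 2
          * empirical x y * empirical x z) := by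
  have h1 : ∑ z, ∑ y, |H t z - H t y| * (g z - g y) ^ 2 * empirical x y * empirical x z
      = (1 / (N : ℝ)) * ((1 / (N : ℝ)) * ∑ i, ∑ j, |H t (x i) - H t (x j)|
        * (g (x i) - g (x j)) ^ 2) := by
    have h2 : ∑ z, ∑ y, |H t z - H t y| * (g z - g y) ^ 2 * empirical x y * empirical x z
        = pairing (fun z => pairing (fun y => |H t z - H t y| * (g z - g y) ^ 2) (empirical x))
          (empirical x) := by
      simp only [pairing, Finset.sum_mul]
    rw [h2, pairing_empirical]
    simp only [pairing_empirical, ← Finset.mul_sum]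
  rw [h1, particleCarre]
  simp only [pairing_empirical_update, add_sub_cancel_left, mul_pow,
    mul_left_comm _ ((1 / (N : ℝ)) ^ 2), ← Finset.mul_sum, hL.sum_mul_sq_sub]
  rw [sum_max_sub_mul_sq_sub (fun i => H t (x i)) (fun i => g (x i))]
  simp only [pairing_empirical, Pi.mul_apply, Finset.sum_sub_distrib, ← Finset.mul_sum]
  ring

end Generator

/-! ### First and second moments of the empirical measure under a product law. -/

section ProductLaw

variable {S : Type*} [Fintype S] {N : ℕ}

theorem sum_prod_mul_prod (ν : S → ℝ) (F : Fin N → S → ℝ) :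
    ∑ x : Fin N → S, (∏ i, ν (x i)) * ∏ i, F i (x i) = ∏ i, pairing (F i) ν := by
  classical
  simp only [pairing]
  rw [Finset.prod_univ_sum, Fintype.piFinset_univ]
  refine Finset.sum_congr rfl fun x _ => ?_
  rw [← Finset.prod_mul_distrib]
  exact Finset.prod_congr rfl fun i _ => mul_comm _ _

theorem sum_prod_mul_apply_mul_apply {ν : S → ℝ} (hν : ∑ x, ν x = 1) (a b : S → ℝ)
    {i j : Fin N} (hij : i ≠ j) :
    ∑ x : Fin N → S, (∏ k, ν (x k)) * (a (x i) * b (x j)) = pairing a ν * pairing b ν := by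
  -- As factors take `a` at `i`, `b` at `j` and `1` elsewhere.
  have h := sum_prod_mul_prod ν
    (fun k y => (if k = i then a y else 1) * (if k = j then b y else 1))
  have h1 : ∀ k, pairing (fun y => (if k = i then a y else 1) * (if k = j then b y else 1)) ν
      = (if k = i then pairing a ν else 1) * (if k = j then pairing b ν else 1) := by
    intro k
    by_cases hi : k = i
    · have hj : k ≠ j := fun hj => hij (hi.symm.trans hj)
      simp [hi, hij]
    · by_cases hj : k = j
      · simp [hj, hij.symm]
      · simp [hi, hj, pairing, hν]
  simp only [h1, Finset.prod_mul_distrib, Finset.prod_ite_eq', Finset.mem_univ, if_true] at h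
  exact h

theorem sum_prod_mul_apply {ν : S → ℝ} (hν : ∑ x, ν x = 1) (a : S → ℝ) (i : Fin N) :
    ∑ x : Fin N → S, (∏ k, ν (x k)) * a (x i) = pairing a ν := by
  have h := sum_prod_mul_prod ν (fun k y => if k = i then a y else 1)
  have h1 : ∀ k, pairing (fun y => if k = i then a y else 1) ν
      = if k = i then pairing a ν else 1 := by
    intro k
    by_cases hi : k = i
    · simp [hi]
    · simp [hi, pairing, hν]
  simp only [h1, Finset.prod_ite_eq', Finset.mem_univ, if_true] at h
  exact h

variable [DecidableEq S]

theorem sum_prod_mul_pairing {ν : S → ℝ} (hν : ∑ x, ν x = 1) (hN : 0 < N) (a : S → ℝ) :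
    ∑ x : Fin N → S, (∏ k, ν (x k)) * pairing a (empirical x) = pairing a ν := by
  have hN' : (N : ℝ) ≠ 0 := by positivity
  simp only [pairing_empirical, mul_left_comm _ (1 / (N : ℝ)), Finset.mul_sum]
  rw [Finset.sum_comm]
  simp only [← Finset.mul_sum, sum_prod_mul_apply hν, Finset.sum_const, Finset.card_univ,
    Fintype.card_fin, nsmul_eq_mul]
  field_simp

/-- By independence the off-diagonal pairs give `⟨a, ν⟩²`; each of the `N` diagonal ones exceeds
this by `var ν a`, out of `N²` pairs. -/
theorem sum_prod_mul_pairing_sq {ν : S → ℝ} (hν : ∑ x, ν x = 1) (hN : 0 < N) (a : S → ℝ) :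
    ∑ x : Fin N → S, (∏ k, ν (x k)) * pairing a (empirical x) ^ 2
      = pairing a ν ^ 2 + (1 / (N : ℝ)) * var ν a := by
  have hN' : (N : ℝ) ≠ 0 := by positivity
  have h1 : ∀ i j : Fin N, ∑ x : Fin N → S, (∏ k, ν (x k)) * (a (x i) * a (x j))
      = pairing a ν ^ 2 + if i = j then var ν a else 0 := by
    intro i j
    by_cases hij : i = j
    · subst hij
      have := sum_prod_mul_apply hν (a ^ 2) i
      simp only [Pi.pow_apply, sq] at this
      rw [this, if_pos rfl, var]
      simp only [sq]
      ring
    · rw [sum_prod_mul_apply_mul_apply hν a a hij, if_neg hij]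
      ring
  have h2 : ∀ x : Fin N → S, (∏ k, ν (x k)) * pairing a (empirical x) ^ 2
      = (1 / (N : ℝ)) ^ 2 * ∑ i, ∑ j, (∏ k, ν (x k)) * (a (x i) * a (x j)) := by
    intro x
    rw [pairing_empirical, mul_pow, sq (∑ i, a (x i)), Finset.sum_mul_sum]
    simp only [← Finset.mul_sum]
    ring
  simp only [h2]
  rw [← Finset.mul_sum, Finset.sum_comm]
  simp_rw [Finset.sum_comm (s := (Finset.univ : Finset (Fin N → S))), h1]
  simp only [Finset.sum_add_distrib, Finset.sum_ite_eq, Finset.mem_univ, if_true,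
    Finset.sum_const, Finset.card_univ, Fintype.card_fin, nsmul_eq_mul]
  field_simp

theorem integral_comp_of_law {E Ω : Type*} [Fintype E] [MeasurableSpace E]
    [MeasurableSingletonClass E] [MeasurableSpace Ω] {P : Measure Ω} [IsProbabilityMeasure P]
    {Y : Ω → E} (hY : Measurable Y) {w : E → ℝ} (hw : ∀ x, P.real {ω | Y ω = x} = w x)
    (φ : E → ℝ) : ∫ ω, φ (Y ω) ∂P = ∑ x, w x * φ x := by
  have := Measure.isProbabilityMeasure_map (μ := P) hY.aemeasurable
  rw [← integral_map hY.aemeasurable (measurable_of_finite φ).aestronglyMeasurable,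
    integral_fintype (Integrable.of_finite)]
  refine Finset.sum_congr rfl fun x _ => ?_
  rw [map_measureReal_apply hY (measurableSet_singleton x), ← hw x]
  rfl

end ProductLaw

/-! ### Test functions built from the propagator, and the two moment identities. -/

section Variance

variable {S : Type*} [Fintype S] {N : ℕ} {lam : ℝ → ℝ} {L : ℝ → Matrix S S ℝ} {H : ℝ → S → ℝ}

theorem backwardField_eq (s : ℝ) (g : S → ℝ) :
    backwardField lam L H s g = H s * g - lam s • (L s *ᵥ g) := by
  funext x
  simp only [backwardField, Pi.sub_apply, Pi.mul_apply, Pi.smul_apply, smul_eq_mul]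
  ring

theorem continuousOn_backwardField {A : Set ℝ} (hlam : ContinuousOn lam A) (hL : ContinuousOn L A)
    (hH : ContinuousOn H A) {g : ℝ → S → ℝ} (hg : ContinuousOn g A) :
    ContinuousOn (fun s => backwardField lam L H s (g s)) A := by
  simp only [backwardField_eq]
  refine (hH.mul hg).sub (hlam.smul (continuousOn_pi.2 fun x => ?_))
  exact continuousOn_finsetSum _ fun y _ => ((continuous_apply_apply x y).comp_continuousOn hL).mul
    ((continuous_apply y).comp_continuousOn hg)

theorem continuousOn_pairing {A : Set ℝ} {g : ℝ → S → ℝ} (hg : ContinuousOn g A) (ν : S → ℝ) :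
    ContinuousOn (fun s => pairing (g s) ν) A :=
  continuousOn_finsetSum _ fun x _ =>
    ((continuous_apply x).comp_continuousOn hg).mul continuousOn_const

theorem hasDerivWithinAt_pairing {A : Set ℝ} {s : ℝ} {g : ℝ → S → ℝ} {g' : S → ℝ}
    (hg : HasDerivWithinAt g g' A s) (ν : S → ℝ) :
    HasDerivWithinAt (fun r => pairing (g r) ν) (pairing g' ν) A s :=
  HasDerivWithinAt.fun_sum fun x _ => (hasDerivWithinAt_pi.1 hg x).mul_const (ν x)

theorem IsBackwardSolution.hasDerivWithinAt_Ici {t : ℝ} {f : S → ℝ} {g : ℝ → S → ℝ}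
    (hg : IsBackwardSolution lam L H t f g) {s : ℝ} (hs : s ∈ Ico 0 t) :
    HasDerivWithinAt g (backwardField lam L H s (g s)) (Ici s) s :=
  ((isBackwardSolution_iff.1 hg).2 s ⟨hs.1, hs.2.le⟩).mono_of_mem_nhdsWithin
    (Filter.mem_of_superset (Icc_mem_nhdsGE hs.2) (Icc_subset_Icc_left hs.1))

theorem IsBackwardSolution.continuousOn {t : ℝ} {f : S → ℝ} {g : ℝ → S → ℝ}
    (hg : IsBackwardSolution lam L H t f g) : ContinuousOn g (Icc 0 t) :=
  fun s hs => ((isBackwardSolution_iff.1 hg).2 s hs).continuousWithinAt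

theorem IsBackwardSolution.hasDerivWithinAt_pairing_sq {t : ℝ} {f f' : S → ℝ} {g q : ℝ → S → ℝ}
    (hg : IsBackwardSolution lam L H t f g) (hq : IsBackwardSolution lam L H t f' q) {s : ℝ}
    (hs : s ∈ Ico 0 t) (c : ℝ) (ν : S → ℝ) :
    HasDerivWithinAt (fun r => pairing (g r) ν ^ 2 + c * pairing (q r - g r ^ 2) ν)
      (2 * pairing (g s) ν * pairing (backwardField lam L H s (g s)) ν
        + c * pairing (backwardField lam L H s (q s)
          - (2 : ℝ) • (g s * backwardField lam L H s (g s))) ν) (Ici s) s := by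
  have hgd := hg.hasDerivWithinAt_Ici hs
  have hg2 : HasDerivWithinAt (fun r => g r ^ 2)
      ((2 : ℝ) • (g s * backwardField lam L H s (g s))) (Ici s) s := by
    refine hasDerivWithinAt_pi.2 fun y => ?_
    have h := (hasDerivWithinAt_pi.1 hgd y).fun_pow 2
    simpa [mul_assoc] using h
  have h1 := (hasDerivWithinAt_pairing hgd ν).fun_pow 2
  have h2 := (hasDerivWithinAt_pairing ((hq.hasDerivWithinAt_Ici hs).fun_sub hg2) ν).const_mul c
  simpa using h1.fun_add h2

/-- Every term is quadratic in `ν`, thanks to the factor `⟨1, ν⟩` in the first. So `V` along the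
reweighted measure is the squared weight times `V` along the empirical one. -/
theorem varianceRate_smul (s t c : ℝ) (f ν : S → ℝ) :
    varianceRate lam L H s t f (c • ν) = c ^ 2 * varianceRate lam L H s t f ν := by
  have h : ∀ a b d : ℝ, a * (c * b) * (c * d) = c ^ 2 * (a * b * d) := fun a b d => by ring
  simp only [varianceRate, pairing_smul_right]
  simp only [Pi.smul_apply, smul_eq_mul, h, ← Finset.mul_sum]
  ring

theorem continuousOn_varianceRate {f : S → ℝ} {t : ℝ} (ht : 0 ≤ t)
    (hlam : ContinuousOn lam (Icc 0 t))
    (hL : ContinuousOn L (Icc 0 t)) (hH : ContinuousOn H (Icc 0 t)) (ν : S → ℝ) :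
    ContinuousOn (fun s => varianceRate lam L H s t f ν) (Icc 0 t) := by
  have hg := (isBackwardSolution_propagator ht hlam hL hH f).continuousOn
  have hq := (isBackwardSolution_propagator ht hlam hL hH (f ^ 2)).continuousOn
  have hcomp : ∀ {u : ℝ → S → ℝ}, ContinuousOn u (Icc 0 t) → ∀ y,
      ContinuousOn (fun s => u s y) (Icc 0 t) := fun hu y =>
    (continuous_apply y).comp_continuousOn hu
  refine (((continuousOn_pairing (hH.mul (hg.pow 2)) _).neg.mul continuousOn_const).sub
    ((continuousOn_pairing hH _).mul (continuousOn_pairing (hq.sub (hg.pow 2)) _))).add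
    (continuousOn_const.mul (continuousOn_finsetSum _ fun z _ =>
      continuousOn_finsetSum _ fun y _ => ?_))
  exact ((((hcomp hH z).sub (hcomp hH y)).abs.mul
    (((hcomp hg z).sub (hcomp hg y)).pow 2)).mul continuousOn_const).mul continuousOn_const

variable [DecidableEq S]

/-- The Feynman-Kac drift of `⟨g, η⟩` for `k = ⟨H, η⟩` vanishes, so the weighted process is a
martingale. -/
theorem backward_pairing_generator (hN : 0 < N) {s : ℝ} (hL : IsQMatrix (L s)) (g : S → ℝ)
    (x : Fin N → S) :
    pairing (backwardField lam L H s g) (empirical x)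
        + particleGenerator lam L H s (fun x => pairing g (empirical x)) x
        - pairing (H s) (empirical x) * pairing g (empirical x) = 0 := by
  rw [particleGenerator_pairing hN hL, backwardField_eq]
  simp only [pairing_sub, pairing_smul]
  ring

/-- The drift for `k = 2⟨H, η⟩`. The square alone leaves its carré du champ, whose part `λ(L g² - 2g
L g)` is cancelled by the drift of `(1/N)⟨q - g², η⟩`. The `H` terms of that correction add up to
`-⟨H g², η⟩ - ⟨H, η⟩⟨q - g², η⟩`. -/
theorem backward_pairing_sq_generator (hN : 0 < N) {s : ℝ} (hL : IsQMatrix (L s)) (g q : S → ℝ)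
    (x : Fin N → S) :
    2 * pairing g (empirical x) * pairing (backwardField lam L H s g) (empirical x)
        + (1 / (N : ℝ)) * pairing (backwardField lam L H s q
            - (2 : ℝ) • (g * backwardField lam L H s g)) (empirical x)
        + particleGenerator lam L H s (fun x => pairing g (empirical x) ^ 2
            + (1 / (N : ℝ)) * pairing (q - g ^ 2) (empirical x)) x
        - 2 * pairing (H s) (empirical x) * (pairing g (empirical x) ^ 2
            + (1 / (N : ℝ)) * pairing (q - g ^ 2) (empirical x))
      = (1 / (N : ℝ)) * (-pairing (H s * g ^ 2) (empirical x) * pairing 1 (empirical x)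
        - pairing (H s) (empirical x) * pairing (q - g ^ 2) (empirical x)
        + (1 / 2) * ∑ z, ∑ y, |H s z - H s y| * (g z - g y) ^ 2
          * empirical x y * empirical x z) := by
  have e1 : g * backwardField lam L H s g = H s * g ^ 2 - lam s • (g * (L s *ᵥ g)) := by
    rw [backwardField_eq]
    funext y
    simp only [Pi.sub_apply, Pi.mul_apply, Pi.smul_apply, Pi.pow_apply, smul_eq_mul]
    ring
  rw [particleGenerator_add, particleGenerator_const_mul, particleGenerator_sq hL,
    particleCarre_pairing hL, particleGenerator_pairing hN hL, particleGenerator_pairing hN hL,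
    e1, backwardField_eq, backwardField_eq, pairing_one_empirical hN, Matrix.mulVec_sub,
    mul_sub (H s) q (g ^ 2)]
  simp only [pairing_sub, pairing_smul]
  ring

variable [MeasurableSpace S] [MeasurableSingletonClass S] [TopologicalSpace S]
  [DiscreteTopology S] {Ω : Type*} [MeasurableSpace Ω] {P : Measure Ω} [IsProbabilityMeasure P]
  {X : ℝ → Ω → Fin N → S} {t C : ℝ} {k : ℝ → (Fin N → S) → ℝ}

theorem IsBackwardSolution.weightedMean_pairing {f : S → ℝ} {g : ℝ → S → ℝ}
    (hg : IsBackwardSolution lam L H t f g) (ht : 0 ≤ t)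
    (hX : IsMarkovProcess (particleGenerator lam L H) X P)
    (hC : ∀ s ∈ Icc 0 t, ∀ φ : (Fin N → S) → ℝ, ‖particleGenerator lam L H s φ‖ ≤ C * ‖φ‖)
    (hN : 0 < N) (hL_gen : ∀ t, 0 ≤ t → IsQMatrix (L t))
    (hlam : ContinuousOn lam (Icc 0 t)) (hL : ContinuousOn L (Icc 0 t))
    (hH : ContinuousOn H (Icc 0 t)) (hk : Continuous k)
    (hkH : ∀ s ∈ Icc 0 t, ∀ x, k s x = pairing (H s) (empirical x)) :
    weightedMean P k X t (fun x => pairing f (empirical x))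
      = weightedMean P k X 0 (fun x => pairing (g 0) (empirical x)) := by
  have hgc := hg.continuousOn
  have hφ : ContinuousOn (fun s (x : Fin N → S) => pairing (g s) (empirical x)) (Icc 0 t) :=
    continuousOn_pi.2 fun x => continuousOn_pairing hgc _
  have hφ' : ContinuousOn (fun s (x : Fin N → S) =>
      pairing (backwardField lam L H s (g s)) (empirical x)) (Icc 0 t) :=
    continuousOn_pi.2 fun x => continuousOn_pairing (continuousOn_backwardField hlam hL hH hgc) _
  have h := hX.integral_weightedMean ht hk hC hφ hφ'
    (fun s hs => hasDerivWithinAt_pi.2 fun x =>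
      hasDerivWithinAt_pairing (hg.hasDerivWithinAt_Ici hs) _)
    (continuousOn_const (c := fun _ => 0))
    (fun s hs x => by
      rw [hkH s hs]
      exact backward_pairing_generator hN (hL_gen s hs.1) (g s) x)
  simp only [weightedMean, mul_zero, integral_zero, intervalIntegral.integral_zero, hg.1] at h ⊢
  linarith

theorem integral_weightedMean_varianceRate {f : S → ℝ} (ht : 0 ≤ t)
    (hX : IsMarkovProcess (particleGenerator lam L H) X P)
    (hC : ∀ s ∈ Icc 0 t, ∀ φ : (Fin N → S) → ℝ, ‖particleGenerator lam L H s φ‖ ≤ C * ‖φ‖)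
    (hN : 0 < N) (hL_gen : ∀ t, 0 ≤ t → IsQMatrix (L t))
    (hlam : ContinuousOn lam (Icc 0 t)) (hL : ContinuousOn L (Icc 0 t))
    (hH : ContinuousOn H (Icc 0 t)) (hk : Continuous k)
    (hkH : ∀ s ∈ Icc 0 t, ∀ x, k s x = 2 * pairing (H s) (empirical x)) :
    (1 / (N : ℝ)) * ∫ s in (0 : ℝ)..t,
        weightedMean P k X s (fun x => varianceRate lam L H s t f (empirical x))
      = weightedMean P k X t (fun x => pairing f (empirical x) ^ 2)
        - weightedMean P k X 0 (fun x => pairing (propagator lam L H 0 t f) (empirical x) ^ 2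
          + (1 / (N : ℝ)) * pairing (propagator lam L H 0 t (f ^ 2)
            - propagator lam L H 0 t f ^ 2) (empirical x)) := by
  have hg := isBackwardSolution_propagator ht hlam hL hH f
  have hq := isBackwardSolution_propagator ht hlam hL hH (f ^ 2)
  have hgt : propagator lam L H t t f = f := hg.1
  have hqt : propagator lam L H t t (f ^ 2) = f ^ 2 := hq.1
  have hgc := hg.continuousOn
  have hqc := hq.continuousOn
  have hgbc := continuousOn_backwardField hlam hL hH hgc
  have hqbc := continuousOn_backwardField hlam hL hH hqc
  have hφ : ContinuousOn (fun s (x : Fin N → S) =>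
      pairing (propagator lam L H s t f) (empirical x) ^ 2 + (1 / (N : ℝ))
        * pairing (propagator lam L H s t (f ^ 2) - propagator lam L H s t f ^ 2) (empirical x))
      (Icc 0 t) :=
    continuousOn_pi.2 fun x => ((continuousOn_pairing hgc _).pow 2).add
      (continuousOn_const.mul (continuousOn_pairing (hqc.sub (hgc.pow 2)) _))
  have hφ' : ContinuousOn (fun s (x : Fin N → S) =>
      2 * pairing (propagator lam L H s t f) (empirical x)
          * pairing (backwardField lam L H s (propagator lam L H s t f)) (empirical x)
        + (1 / (N : ℝ)) * pairing (backwardField lam L H s (propagator lam L H s t (f ^ 2))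
          - (2 : ℝ) • (propagator lam L H s t f
            * backwardField lam L H s (propagator lam L H s t f))) (empirical x)) (Icc 0 t) :=
    continuousOn_pi.2 fun x => ((continuousOn_const.mul (continuousOn_pairing hgc _)).mul
      (continuousOn_pairing hgbc _)).add (continuousOn_const.mul
      (continuousOn_pairing (hqbc.sub ((hgc.mul hgbc).const_smul (2 : ℝ))) _))
  have hψ : ContinuousOn (fun s (x : Fin N → S) =>
      (1 / (N : ℝ)) * varianceRate lam L H s t f (empirical x)) (Icc 0 t) :=
    continuousOn_pi.2 fun x => continuousOn_const.mul (continuousOn_varianceRate ht hlam hL hH _)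
  have h := hX.integral_weightedMean ht hk hC hφ hφ'
    (fun s hs => hasDerivWithinAt_pi.2 fun x => hg.hasDerivWithinAt_pairing_sq hq hs _ _) hψ
    (fun s hs x => by
      rw [hkH s hs]
      exact backward_pairing_sq_generator hN (hL_gen s hs.1) _ _ x)
  -- At `s = t` both `q` and `g²` equal `f²`, so the correction drops out there.
  have hz : ∀ x : Fin N → S, pairing (0 : S → ℝ) (empirical x) = 0 := fun x => by simp [pairing]
  simp only [hgt, hqt, sub_self, hz, mul_zero, add_zero] at h
  rw [← h, ← intervalIntegral.integral_const_mul]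
  simp only [weightedMean, mul_left_comm _ (1 / (N : ℝ)), integral_const_mul]

end Variance

end ParticleSystem

/-! ### The mean and variance identities. -/

open ParticleSystem in
theorem proposition2p1
    {S : Type*} [Fintype S] [DecidableEq S] [MeasurableSpace S] [MeasurableSingletonClass S]
    [TopologicalSpace S] [DiscreteTopology S]
    (U μ : ℝ → S → ℝ) (hμ : IsGibbsFamily U μ)
    (lam : ℝ → ℝ) (hlam_nonneg : ∀ t, 0 ≤ t → 0 ≤ lam t) (hlam_cont : ContinuousOn lam (Ici 0))
    (L : ℝ → Matrix S S ℝ) (hL_gen : ∀ t, 0 ≤ t → IsQMatrix (L t))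
    (hL_cont : ContinuousOn L (Ici 0))
    (hL_db : ∀ t, 0 ≤ t → DetailedBalance (μ t) (L t))
    (N : ℕ) (hN : 0 < N)
    {Ω : Type*} [MeasurableSpace Ω] (P : Measure Ω) [IsProbabilityMeasure P]
    (X : ℝ → Ω → Fin N → S)
    (hX : IsMarkovProcess (particleGenerator lam L (negLogDeriv μ)) X P)
    (hX_init : ∀ x : Fin N → S, P.real {ω | X 0 ω = x} = ∏ i, μ 0 (x i))
    (f : S → ℝ) (t : ℝ) (ht : 0 ≤ t) :
    let H := negLogDeriv μ
    let ν : ℝ → Ω → S → ℝ := fun s ω => reweighted H (fun r => X r ω) s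
    let V : ℝ → Ω → ℝ := fun s ω => varianceRate lam L H s t f (ν s ω)
    (Integrable (fun ω => pairing f (ν t ω)) P ∧
      ∫ ω, pairing f (ν t ω) ∂P = pairing f (μ t)) ∧
    (Integrable (fun ω => |pairing f (ν t ω) - pairing f (μ t)| ^ 2) P ∧
      (∀ s ∈ Icc 0 t, Integrable (V s) P) ∧
      IntervalIntegrable (fun s => ∫ ω, V s ω ∂P) volume 0 t ∧
      ∫ ω, |pairing f (ν t ω) - pairing f (μ t)| ^ 2 ∂P
        = (1 / (N : ℝ)) * var (μ t) f + (1 / (N : ℝ)) * ∫ s in (0 : ℝ)..t, ∫ ω, V s ω ∂P) := by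
  intro H ν V
  have hHc : ContinuousOn H (Ici 0) := hμ.continuousOn_negLogDeriv
  have hsub : Icc 0 t ⊆ Ici (0 : ℝ) := Icc_subset_Ici_self
  have hlamt := hlam_cont.mono hsub
  have hLt := hL_cont.mono hsub
  have hHt := hHc.mono hsub
  set g : ℝ → S → ℝ := fun s => propagator lam L H s t f
  set q : ℝ → S → ℝ := fun s => propagator lam L H s t (f ^ 2)
  have hg : IsBackwardSolution lam L H t f g :=
    isBackwardSolution_propagator ht hlamt hLt hHt f
  have hq : IsBackwardSolution lam L H t (f ^ 2) q :=
    isBackwardSolution_propagator ht hlamt hLt hHt (f ^ 2)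
  have hg0 := hμ.pairing_backwardSolution hL_gen hL_db ht hg
  have hq0 := hμ.pairing_backwardSolution hL_gen hL_db ht hq
  obtain ⟨C, hC⟩ := exists_norm_particleGenerator_le (N := N) hlamt hLt hHt
  -- The potential with multiplicity `c`: `1` for the mean, `2` for the second moment. Freezing `H`
  -- at negative times makes it continuous on all of `ℝ`, as the Feynman-Kac lemmas require.
  set k : ℝ → ℝ → (Fin N → S) → ℝ := fun c r x => c * pairing (H (max r 0)) (empirical x)
    with hk_def
  have hk : ∀ c, Continuous (k c) := fun c => by
    have hHm : Continuous fun r => H (max r 0) :=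
      hHc.comp_continuous (continuous_id.max continuous_const) fun r =>
        mem_Ici.2 (le_max_right r 0)
    refine continuous_pi fun x => continuous_const.mul ?_
    exact continuous_finsetSum _ fun y _ =>
      ((continuous_apply y).comp hHm).mul continuous_const
  have hA : ∀ c s, 0 ≤ s → ∀ ω, additiveFunctional (k c) X s ω
      = c * ∫ r in (0 : ℝ)..s, pairing (H r) (empirical (X r ω)) := by
    intro c s hs ω
    rw [additiveFunctional, ← intervalIntegral.integral_const_mul]
    refine intervalIntegral.integral_congr fun r hr => ?_
    rw [uIcc_of_le hs] at hr
    simp only [hk_def, max_eq_left hr.1]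
  have hν : ∀ s, 0 ≤ s → ∀ ω, ν s ω = weight (k 1) X s ω • empirical (X s ω) := by
    intro s hs ω
    funext y
    simp only [ν, reweighted, weight, hA 1 s hs, one_mul, Pi.smul_apply, smul_eq_mul]
  have hw2 : ∀ s, 0 ≤ s → ∀ ω, weight (k 1) X s ω ^ 2 = weight (k 2) X s ω := by
    intro s hs ω
    rw [weight, weight, hA 1 s hs, hA 2 s hs, ← Real.exp_nat_mul]
    congr 1
    push_cast
    ring
  have hmean0 : ∀ c (φ : (Fin N → S) → ℝ),
      weightedMean P (k c) X 0 φ = ∑ x, (∏ i, μ 0 (x i)) * φ x := by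
    intro c φ
    rw [← integral_comp_of_law (hX.measurable 0 le_rfl) hX_init φ]
    simp [weightedMean, weight, additiveFunctional]
  have hf : ∀ ω, pairing f (ν t ω) = weight (k 1) X t ω * pairing f (empirical (X t ω)) :=
    fun ω => by rw [hν t ht, pairing_smul_right]
  have hf2 : ∀ ω, pairing f (ν t ω) ^ 2
      = weight (k 2) X t ω * pairing f (empirical (X t ω)) ^ 2 := fun ω => by
    rw [hf, mul_pow, hw2 t ht]
  have hfint : Integrable (fun ω => pairing f (ν t ω)) P := by
    simp only [hf]
    exact hX.integrable_weight_mul (hk 1) ht ht fun x => pairing f (empirical x)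
  have hf2int : Integrable (fun ω => pairing f (ν t ω) ^ 2) P := by
    simp only [hf2]
    exact hX.integrable_weight_mul (hk 2) ht ht fun x => pairing f (empirical x) ^ 2
  have hfirst : ∫ ω, pairing f (ν t ω) ∂P = pairing f (μ t) := by
    have h := hg.weightedMean_pairing ht hX hC hN hL_gen hlamt hLt hHt (hk 1)
      (fun s hs x => by simp only [hk_def, max_eq_left hs.1, one_mul])
    rw [hmean0, sum_prod_mul_pairing hμ.initial_sum hN, hg0] at h
    simp only [hf]
    exact h
  set ψ : ℝ → (Fin N → S) → ℝ := fun s x => varianceRate lam L H s t f (empirical x) with hψ_def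
  have hψc : ContinuousOn ψ (Icc 0 t) :=
    continuousOn_pi.2 fun x => continuousOn_varianceRate ht hlamt hLt hHt _
  have hV : ∀ s, 0 ≤ s → ∀ ω, V s ω = weight (k 2) X s ω * ψ s (X s ω) := by
    intro s hs ω
    simp only [V, hν s hs, varianceRate_smul, hw2 s hs, hψ_def]
  have hVmean : ∀ s, 0 ≤ s → ∫ ω, V s ω ∂P = weightedMean P (k 2) X s (ψ s) := fun s hs =>
    integral_congr_ae (Filter.Eventually.of_forall (hV s hs))
  have hVint : ∀ s ∈ Icc 0 t, Integrable (V s) P := by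
    intro s hs
    rw [funext (hV s hs.1)]
    exact hX.integrable_weight_mul (hk 2) hs.1 hs.1 (ψ s)
  have hVc : ContinuousOn (fun s => ∫ ω, V s ω ∂P) (Icc 0 t) :=
    (hX.continuousOn_weightedMean (hk 2) hC hψc).congr fun s hs => hVmean s hs.1
  have hsecond : ∫ ω, pairing f (ν t ω) ^ 2 ∂P = pairing f (μ t) ^ 2
      + (1 / (N : ℝ)) * var (μ t) f + (1 / (N : ℝ)) * ∫ s in (0 : ℝ)..t, ∫ ω, V s ω ∂P := by
    have h := integral_weightedMean_varianceRate (f := f) ht hX hC hN hL_gen hlamt hLt hHt (hk 2)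
      (fun s hs x => by
        simp only [hk_def, max_eq_left hs.1]
        rfl)
    have hl : ∫ s in (0 : ℝ)..t, ∫ ω, V s ω ∂P
        = ∫ s in (0 : ℝ)..t, weightedMean P (k 2) X s (ψ s) := by
      refine intervalIntegral.integral_congr fun s hs => ?_
      rw [uIcc_of_le ht] at hs
      exact hVmean s hs.1
    -- The sampling variance contributes `⟨g_0², μ_0⟩/N`, which the correction cancels and replaces
    -- by `⟨q_0, μ_0⟩/N = ⟨f², μ_t⟩/N`.
    have hr0 : weightedMean P (k 2) X 0 (fun x => pairing (g 0) (empirical x) ^ 2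
        + (1 / (N : ℝ)) * pairing (q 0 - g 0 ^ 2) (empirical x))
        = pairing f (μ t) ^ 2 + (1 / (N : ℝ)) * var (μ t) f := by
      rw [hmean0]
      simp only [mul_add, Finset.sum_add_distrib, mul_left_comm _ (1 / (N : ℝ)),
        ← Finset.mul_sum]
      rw [sum_prod_mul_pairing hμ.initial_sum hN, sum_prod_mul_pairing_sq hμ.initial_sum hN,
        pairing_sub, var, var, hg0, hq0]
      ring
    have hrt : weightedMean P (k 2) X t (fun x => pairing f (empirical x) ^ 2)
        = ∫ ω, pairing f (ν t ω) ^ 2 ∂P := by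
      simp only [weightedMean, hf2]
    rw [hrt] at h
    rw [hl, ← hr0]
    linarith
  refine ⟨⟨hfint, hfirst⟩, ?_, hVint, hVc.intervalIntegrable_of_Icc ht, ?_⟩
  · simp only [sq_abs, sub_sq]
    exact (hf2int.sub ((hfint.const_mul 2).mul_const _)).add (integrable_const _)
  · have he : ∀ ω, |pairing f (ν t ω) - pairing f (μ t)| ^ 2 = (pairing f (ν t ω) ^ 2
        - (2 * pairing f (μ t)) * pairing f (ν t ω)) + pairing f (μ t) ^ 2 := fun ω => by
      rw [sq_abs]
      ring
    simp only [he]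
    have h1 := integral_add (hf2int.sub (hfint.const_mul (2 * pairing f (μ t))))
      (integrable_const (μ := P) (pairing f (μ t) ^ 2))
    rw [integral_sub' hf2int (hfint.const_mul _), integral_const_mul, hfirst, hsecond] at h1
    refine h1.trans ?_
    simp
    ring
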